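/- Conventions. All graphs are finite. A tripartite 3-graph $H=(U\cup V\cup W,F)$ is a 3-uniform hypergraph on the disjoint union $U\cup V\cup W$, each of whose edges meets each of $U,V,W$ in at most one vertex. Write $K_2[X,Y]$ for the set of pairs $xy$ with $x\in X$, $y\in Y$, $x\ne y$, and $N_H(yz)=\{x: xyz\in F\}$. The slice graph $H_x$ has vertex set $V(H)$ and edges $\{yz: xyz\in F\}$; $E(H_x)^1$ is its edge set and $E(H_x)^0$ the set of the other pairs of distinct vertices. The VC-dimension of a graph is the largest $k$ for which there are vertices $a_i$ ($i\in[k]$) and $b_S$ ($S\subseteq[k]$) with $a_ib_S$ an edge if and only if $i\in S$, and $\mathrm{SVC}(H)=\max_{x\in V(H)}\mathrm{VC}(H_x)$. A set $X\subseteq V$ is almost $\eta$-good with respect to $H$ if at least $(1-\eta)|U||W|$ pairs $(y,z)\in U\times W$ satisfy $|N_H(yz)\cap X|/|X|\in[0,\eta)\cup(1-\eta,1]$; a partition $\mathcal P$ of $V$ is almost $\eta$-good if there is $\mathcal P'\subseteq\mathcal P$ with $|\bigcup\mathcal P'|\ge(1-\eta)|V|$ all of whose members are almost $\eta$-good. A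 bipartite edge-colored graph $(A\cup B,E_0,E_1,E_2)$ consists of disjoint sets $A,B$ and a partition $K_2[A,B]=E_0\sqcup E_1\sqcup E_2$. It has an $E_0/E_1$-copy of $U(k)$ if there are vertices $x_i$ ($i\in[k]$) in one of $A,B$ and $y_S$ ($S\subseteq[k]$) in the other such that $x_iy_S\in E_0$ when $i\in S$ and $x_iy_S\in E_1$ when $i\notin S$. A pair of partitions $(\mathcal P_A,\mathcal P_B)$ of $A$ and $B$ is $\eta$-homogeneous if there are $\Sigma_0,\Sigma_1\subseteq\mathcal P_A\times\mathcal P_B$ with $|\bigcup_{(X,Y)\in\Sigma_0\cup\Sigma_1}K_2[X,Y]|\ge(1-\eta)|A||B|$ and $|E_\tau\cap K_2[X,Y]|\ge(1-\eta)|X||Y|$ for all $\tau\in\{0,1\}$ and $(X,Y)\in\Sigma_\tau$. For $k\ge1$ call $c>0$ a removal constant for $k$ if for all $0<\epsilon,\delta<1/2$ with $\epsilon\le c^{-4}(\delta/8)^{4k+4}/8$, every bipartite edge-colored graph $(A\cup B,E_0,E_1,E_2)$ with $|E_2|\le\epsilon|A||B|$ and without $E_0/E_1$-copy of $U(k)$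 has a $2\delta^{1/16}$-homogeneous pair of partitions $(\mathcal P_A,\mathcal P_B)$ with $\max\{|\mathcal P_A|,|\mathcal P_B|\}\le 2c(\delta/8)^{-k}$. Proposition. Let $k\ge1$. Removal constants for $k$ exist. Let $c$ be any removal constant for $k$, and let $\ell\ge1$. Then there is $\epsilon_0>0$ (depending on $k,c,\ell$) such that for every $0<\epsilon<\epsilon_0$ there is $n_0$ such that the following holds with $\mu=8(16\epsilon^{1/16}c^4)^{1/(4k+4)}$. Let $1\le r,s\le\ell$ and assume: 1. $H=(U\cup V\cup W,F)$ is a tripartite 3-graph with at least $n_0$ vertices and $\mathrm{SVC}(H)<k$. 2. $\mathcal G=(P\cup Q,F_0,F_1,F_2)$ is a bipartite edge-colored graph with $P=\{p_0,\dots,p_r\}$ and $Q=\{q_0,\dots,q_s\}$, where $|P|=r+1$ and $|Q|=s+1$. 3. For every $x\in U$ there are partitions $V=B_x^0\cup\dots\cup B_x^r$ and $W=C_x^0\cup\dots\cup C_x^s$ (into possibly empty sets) such that: (a) for $\tau\in\{0,1\}$ and $p_iq_j\in F_\tau$, $|E(H_x)^\tau\cap K_2[B_x^i,C_x^j]|\ge(1-\epsilon)|B_x^i||C_x^j|$;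 (b) $|B_x^i|=|C_x^j|=|W|/\ell$ for $1\le i\le r$ and $1\le j\le s$; (c) $|B_x^0|\le\epsilon|V|$ and $|C_x^0|\le\epsilon|W|$. 4. For $1\le i\le r$ and $1\le j\le s$, $|\{q\in Q:p_iq\in F_2\}|\le\epsilon|Q|$ and $|\{p\in P:pq_j\in F_2\}|\le\epsilon|P|$. Then $V$ has a partition $\mathcal P_V$ that is almost $6\mu^{1/512}$-good with respect to $H$ and satisfies $$|\mathcal P_V|\le\bigl(2c(\mu/8)^{-k}\bigr)^{\ell(2\ell)^{\ell}\epsilon^{-\ell}}.$$ -/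

import Mathlib

namespace SliceReg

/-- `t ∈ [0, ε) ∪ (1 - ε, 1]`. -/
def NearZeroOne (ε t : ℝ) : Prop :=
  t ∈ Set.Ico 0 ε ∪ Set.Ioc (1 - ε) 1

/-- The sets `B 0, …, B m` (some possibly empty) are pairwise disjoint with union `X`. -/
def IsIndexedPartition {α : Type*} [DecidableEq α] {m : ℕ} (X : Finset α)
    (B : Fin (m + 1) → Finset α) : Prop :=
  (∀ i j, i ≠ j → Disjoint (B i) (B j)) ∧ Finset.univ.biUnion B = X

section Graphs

/-- There are vertices `a i` (`i ∈ [k]`) and `b S` (`S ⊆ [k]`) such that `a i` is adjacent to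
`b S` if and only if `i ∈ S`. -/
def HasPowerSetConfig {α : Type*} (G : SimpleGraph α) (k : ℕ) : Prop :=
  ∃ (a : Fin k → α) (b : Finset (Fin k) → α), ∀ i S, G.Adj (a i) (b S) ↔ i ∈ S

/-- The VC-dimension of a graph: the largest `k` with such a configuration. -/
noncomputable def vcDim {α : Type*} (G : SimpleGraph α) : ℕ∞ :=
  ⨆ (k : ℕ) (_ : HasPowerSetConfig G k), (k : ℕ∞)

end Graphs

section ThreeGraphs

/-- A 3-uniform hypergraph with vertex set `α`. -/
structure ThreeGraph (α : Type*) where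
  edges : Set (Finset α)
  card_of_mem : ∀ e ∈ edges, e.card = 3

variable {α : Type*} [DecidableEq α]

/-- `H` is tripartite with vertex partition `U ∪ V ∪ W`. -/
def ThreeGraph.IsTripartite [Fintype α] (H : ThreeGraph α) (U V W : Finset α) : Prop :=
  Disjoint U V ∧ Disjoint U W ∧ Disjoint V W ∧ U ∪ V ∪ W = Finset.univ ∧
    ∀ e ∈ H.edges, (e ∩ U).card ≤ 1 ∧ (e ∩ V).card ≤ 1 ∧ (e ∩ W).card ≤ 1

/-- The slice graph `H_x`, on the whole vertex set of `H`. -/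
def ThreeGraph.slice (H : ThreeGraph α) (x : α) : SimpleGraph α where
  Adj y z := y ≠ z ∧ ({x, y, z} : Finset α) ∈ H.edges
  symm := ⟨fun y z h => ⟨h.1.symm, by rw [Finset.pair_comm z y]; exact h.2⟩⟩
  loopless := ⟨fun _ h => h.1 rfl⟩

/-- The slicewise VC-dimension of `H`. -/
noncomputable def ThreeGraph.svc (H : ThreeGraph α) : ℕ∞ :=
  ⨆ x : α, vcDim (H.slice x)

open Classical in
/-- `N_H(yz)`. -/
noncomputable def ThreeGraph.nbhd [Fintype α] (H : ThreeGraph α) (y z : α) : Finset α :=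
  Finset.univ.filter fun x => ({y, z, x} : Finset α) ∈ H.edges

open Classical in
/-- `X`, a subset of one part of a tripartite 3-graph `H` whose two other parts are `Y` and `Z`,
is almost `ε`-good with respect to `H`. -/
def ThreeGraph.IsAlmostGood [Fintype α] (H : ThreeGraph α) (Y Z : Finset α) (ε : ℝ)
    (X : Finset α) : Prop :=
  (1 - ε) * (Y.card : ℝ) * (Z.card : ℝ) ≤
    (((Y ×ˢ Z).filter fun p =>
      NearZeroOne ε (((H.nbhd p.1 p.2 ∩ X).card : ℝ) / (X.card : ℝ))).card : ℝ)

/-- The partition `P` of the part `X` of a tripartite 3-graph `H` whose two other parts are `Y`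
and `Z` is almost `ε`-good with respect to `H`: almost good parts cover at least
`(1 - ε) |X|` elements of `X`. -/
def ThreeGraph.IsAlmostGoodPartition [Fintype α] (H : ThreeGraph α) (Y Z : Finset α) (ε : ℝ)
    {X : Finset α} (P : Finpartition X) : Prop :=
  ∃ P' ⊆ P.parts, (1 - ε) * (X.card : ℝ) ≤ ((P'.biUnion id).card : ℝ) ∧
    ∀ S ∈ P', H.IsAlmostGood Y Z ε S

open Classical in
/-- `|E(G)^τ ∩ K₂[X, Y]|` for disjoint `X` and `Y`, where `E(G)^1 = E(G)` (for `τ = true`) and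
`E(G)^0` is the set of non-adjacent pairs of distinct vertices (for `τ = false`). -/
noncomputable def signedEdgeCount [Fintype α] (G : SimpleGraph α) (τ : Bool)
    (X Y : Finset α) : ℕ :=
  (if τ then G.interedges X Y else Gᶜ.interedges X Y).card

end ThreeGraphs

section ColoredGraphs

/-- A bipartite edge-colored graph `(A ∪ B, E₀, E₁, E₂)`: the pairs in `A × B` are partitioned
into the three classes `E_u = {(a, b) | color a b = u}`. -/
structure ColoredBipartite (A B : Type*) where
  color : A → B → Fin 3

namespace ColoredBipartite

variable {A B : Type*}

/-- The edge color `E_u`. -/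
def edgeClass [Fintype A] [Fintype B] (G : ColoredBipartite A B) (u : Fin 3) : Finset (A × B) :=
  Finset.univ.filter fun p => G.color p.1 p.2 = u

/-- `N_{E_u}(a)` for `a ∈ A`. -/
def nbhdLeft [Fintype B] (G : ColoredBipartite A B) (u : Fin 3) (a : A) : Finset B :=
  Finset.univ.filter fun b => G.color a b = u

/-- `N_{E_u}(b)` for `b ∈ B`. -/
def nbhdRight [Fintype A] (G : ColoredBipartite A B) (u : Fin 3) (b : B) : Finset A :=
  Finset.univ.filter fun a => G.color a b = u

/-- There is an `E_u/E_v`-copy of `U(k)` in `G`, with right side in `B` or with right side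
in `A`. -/
def HasCopy (G : ColoredBipartite A B) (u v : Fin 3) (k : ℕ) : Prop :=
  (∃ (x : Fin k → A) (y : Finset (Fin k) → B), ∀ i S,
      (i ∈ S → G.color (x i) (y S) = u) ∧ (i ∉ S → G.color (x i) (y S) = v)) ∨
  (∃ (x : Fin k → B) (y : Finset (Fin k) → A), ∀ i S,
      (i ∈ S → G.color (y S) (x i) = u) ∧ (i ∉ S → G.color (y S) (x i) = v))

/-- `(P, Q)` is `ε`-homogeneous for `G` with respect to `{E₀, E₁}`. -/
def IsHomogeneous [Fintype A] [Fintype B] [DecidableEq A] [DecidableEq B]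
    (G : ColoredBipartite A B) (ε : ℝ) (P : Finpartition (Finset.univ : Finset A))
    (Q : Finpartition (Finset.univ : Finset B)) : Prop :=
  ∃ S₀ ⊆ P.parts ×ˢ Q.parts, ∃ S₁ ⊆ P.parts ×ˢ Q.parts,
    (1 - ε) * (Fintype.card A : ℝ) * (Fintype.card B : ℝ) ≤
      (((S₀ ∪ S₁).biUnion fun p => p.1 ×ˢ p.2).card : ℝ) ∧
    (∀ p ∈ S₀, (1 - ε) * (p.1.card : ℝ) * (p.2.card : ℝ) ≤
      ((G.edgeClass 0 ∩ p.1 ×ˢ p.2).card : ℝ)) ∧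
    (∀ p ∈ S₁, (1 - ε) * (p.1.card : ℝ) * (p.2.card : ℝ) ≤
      ((G.edgeClass 1 ∩ p.1 ×ˢ p.2).card : ℝ))

end ColoredBipartite

/-- `c` is a constant for `k` in the structure theorem for bipartite edge-colored graphs with few
edges of color `E₂` and without `E₀/E₁`-copies of `U(k)`. -/
def IsRemovalConstant (k : ℕ) (c : ℝ) : Prop :=
  0 < c ∧
  ∀ ε δ : ℝ, 0 < ε → ε < 1 / 2 → 0 < δ → δ < 1 / 2 →
    ε ≤ (c ^ 4)⁻¹ * (δ / 8) ^ (4 * k + 4) / 8 →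
  ∀ (A B : Type) [Fintype A] [Fintype B] [DecidableEq A] [DecidableEq B]
    (G : ColoredBipartite A B),
    ((G.edgeClass 2).card : ℝ) ≤ ε * (Fintype.card A : ℝ) * (Fintype.card B : ℝ) →
    ¬ G.HasCopy 0 1 k →
    ∃ (P : Finpartition (Finset.univ : Finset A)) (Q : Finpartition (Finset.univ : Finset B)),
      G.IsHomogeneous (2 * δ ^ (1 / 16 : ℝ)) P Q ∧
      (P.parts.card : ℝ) ≤ 2 * c * ((δ / 8) ^ k)⁻¹ ∧
      (Q.parts.card : ℝ) ≤ 2 * c * ((δ / 8) ^ k)⁻¹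

end ColoredGraphs

/-- `μ = 8 (16 ε^{1/16} c⁴)^{1/(4k+4)}`. -/
noncomputable def muParam (k : ℕ) (c ε : ℝ) : ℝ :=
  8 * (16 * ε ^ (1 / 16 : ℝ) * c ^ 4) ^ (1 / (4 * (k : ℝ) + 4))

/-- The edge-colored graph `𝒢` with vertex classes `p_0, …, p_r` and `q_0, …, q_s` is a reduced
graph of the slice graph `H_x` through partitions `B^0 ∪ … ∪ B^r` of `V` and `C^0 ∪ … ∪ C^s`
of `W`, where `B^0` and `C^0` are exceptional and the other sets all have size `|W| / ℓ`. -/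
def IsReducedSlice {α : Type*} [Fintype α] [DecidableEq α] (H : ThreeGraph α) (V W : Finset α)
    (ℓ : ℕ) (ε : ℝ) {r s : ℕ} (𝒢 : ColoredBipartite (Fin (r + 1)) (Fin (s + 1))) (x : α) :
    Prop :=
  ∃ (B : Fin (r + 1) → Finset α) (C : Fin (s + 1) → Finset α),
    IsIndexedPartition V B ∧ IsIndexedPartition W C ∧
    (∀ i j, 𝒢.color i j = 0 →
      (1 - ε) * ((B i).card : ℝ) * ((C j).card : ℝ) ≤
        (signedEdgeCount (H.slice x) false (B i) (C j) : ℝ)) ∧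
    (∀ i j, 𝒢.color i j = 1 →
      (1 - ε) * ((B i).card : ℝ) * ((C j).card : ℝ) ≤
        (signedEdgeCount (H.slice x) true (B i) (C j) : ℝ)) ∧
    (∀ i, i ≠ 0 → ((B i).card : ℝ) = (W.card : ℝ) / (ℓ : ℝ)) ∧
    (∀ j, j ≠ 0 → ((C j).card : ℝ) = (W.card : ℝ) / (ℓ : ℝ)) ∧
    ((B 0).card : ℝ) ≤ ε * (V.card : ℝ) ∧ ((C 0).card : ℝ) ≤ ε * (W.card : ℝ)

end SliceReg

open SliceReg

/-! The two assertions share one tool, a packing bound. If a bipartite relation shatters no `k`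
points and the elements of a family pairwise differ on a `q`-fraction of the other side, then
boundedly many points distinguish all of them, and Sauer–Shelah bounds the family polynomially in `1
/ q`. A maximal separated family is then a net, so the vertices fall into few clusters of small
diameter (`exists_clustering`), even in the presence of a sparse third color.

Removal constants: cluster both sides. A pair of cells in which colors `0` and `1` are both frequent
forces, by an exchange argument (`card_mul_card_le`), either many differences inside the clusters or
many edges of color `2`. Both are rare on average, so almost all of `A × B` lies in homogeneous
cells.

Almost good partitions: write `ε = s ^ 2`. For small `ε` the degree condition on `𝒢` leaves no edge
of color `2` in a column `j ≠ 0`. In the slice of `x ∈ U`, most vertices of `C j` thus have nearly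
the same neighborhood in `V`, namely the union of the `B i` with color `1`. Hence most `z ∈ W` look,
from `x`, like a proportion `1 / (2 ℓ)` of all `z' ∈ W` (`IsReducedSlice.exists_exceptional`). A
greedy choice of about `1 / s` vertices `T ⊆ W` therefore contains such a `z'` for most pairs `(x,
z)`.

For each `z' ∈ T` the slice at `z'`, between `U` and `V`, has bounded VC-dimension and yields a
clustering of `V`; the partition sought is the common refinement over `T`. Whether `xyz` is an edge
is predicted by replacing `z` with its substitute `z' ∈ T` and `y` with a representative of its
class. The total error is `O(ℓ s)`, which is below the cube of the required goodness, and two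
applications of Markov's inequality finish. The number of parts is only exponential in `(1 / s) log
(1 / s)`, far below the allowed bound, whose base is at least `2` and whose exponent is at least `1
/ s ^ 2`. -/

namespace SliceReg

/-! ### Hitting sets, Sauer–Shelah and the packing bound -/

/-- Greedy hitting sets: if every `G i` has density at least `q` in `W`, then some `t` elements of
`W` miss at most a `(1 - q) ^ t` fraction of the sets `G i`. -/
theorem exists_hitting_set {ι β : Type*} [DecidableEq β] (I : Finset ι) (W : Finset β)
    (hW : W.Nonempty) (G : ι → Finset β) {q : ℝ}
    (hq : q ≤ 1) (hG : ∀ i ∈ I, q * (W.card : ℝ) ≤ ((W ∩ G i).card : ℝ)) (t : ℕ) :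
    ∃ T ⊆ W, T.card ≤ t ∧
      ((I.filter fun i => ∀ w ∈ T, w ∉ G i).card : ℝ) ≤ (1 - q) ^ t * (I.card : ℝ) := by
  classical
  induction t with
  | zero => exact ⟨∅, by simp, by simp, by simp⟩
  | succ t ih =>
    obtain ⟨T, hTW, hTc, hT⟩ := ih
    set J := I.filter fun i => ∀ w ∈ T, w ∉ G i with hJ
    -- Double counting: every set not yet hit contains a `q`-fraction of `W`, so an average `w` hits
    -- a `q`-fraction of these sets.
    have hsum : ∑ w ∈ W, q * (J.card : ℝ) ≤
        ∑ w ∈ W, ((J.filter fun i => w ∈ G i).card : ℝ) := by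
      have h1 : ∑ w ∈ W, ((J.filter fun i => w ∈ G i).card : ℝ)
          = ∑ i ∈ J, ((W ∩ G i).card : ℝ) := by
        have := Finset.sum_card_bipartiteAbove_eq_sum_card_bipartiteBelow
          (s := W) (t := J) (fun w i => w ∈ G i)
        simp only [Finset.bipartiteAbove, Finset.bipartiteBelow, Finset.filter_mem_eq_inter] at this
        exact_mod_cast this
      rw [h1]
      calc ∑ w ∈ W, q * (J.card : ℝ) = ∑ i ∈ J, q * (W.card : ℝ) := by
            simp only [Finset.sum_const, nsmul_eq_mul]; ring
        _ ≤ _ := Finset.sum_le_sum fun i hi => hG i (Finset.mem_filter.1 hi).1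
    obtain ⟨w, hw, hwq⟩ := Finset.exists_le_of_sum_le hW hsum
    refine ⟨insert w T, Finset.insert_subset hw hTW, (Finset.card_insert_le _ _).trans (by omega), ?_⟩
    have hsplit := Finset.card_filter_add_card_filter_not (s := J) (fun i => w ∈ G i)
    have heq : (I.filter fun i => ∀ v ∈ insert w T, v ∉ G i) = J.filter fun i => ¬ w ∈ G i := by
      ext i
      simp only [hJ, Finset.mem_filter, Finset.mem_insert, forall_eq_or_imp]
      tauto
    rw [heq]
    have hs : ((J.filter fun i => w ∈ G i).card : ℝ) + ((J.filter fun i => ¬ w ∈ G i).card : ℝ)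
      = J.card := by exact_mod_cast hsplit
    calc ((J.filter fun i => ¬ w ∈ G i).card : ℝ) ≤ (1 - q) * J.card := by linarith
      _ ≤ (1 - q) * ((1 - q) ^ t * I.card) := by
          apply mul_le_mul_of_nonneg_left hT; linarith
      _ = _ := by ring

/-- The number of subsets with fewer than `k` elements. -/
theorem card_filter_powerset_card_lt_le {β : Type*} (T : Finset β) (k : ℕ) :
    (T.powerset.filter fun s => s.card < k).card ≤ (T.card + 1) ^ k := by
  classical
  have h : (T.powerset.filter fun s => s.card < k) ⊆
      (Finset.range k).biUnion fun i => T.powersetCard i := by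
    intro s hs
    simp only [Finset.mem_filter, Finset.mem_powerset] at hs
    simp only [Finset.mem_biUnion, Finset.mem_range, Finset.mem_powersetCard]
    exact ⟨s.card, hs.2, hs.1, rfl⟩
  calc _ ≤ _ := Finset.card_le_card h
    _ ≤ ∑ i ∈ Finset.range k, (T.powersetCard i).card := Finset.card_biUnion_le
    -- The factor `k.choose i ≥ 1` is inserted so that the sum, with the term `i = k` added, becomes
    -- a binomial expansion.
    _ ≤ ∑ i ∈ Finset.range k, T.card ^ i * k.choose i := by
        refine Finset.sum_le_sum fun i hi => ?_
        rw [Finset.card_powersetCard]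
        exact (Nat.choose_le_pow _ _).trans
          (Nat.le_mul_of_pos_right _ (Nat.choose_pos (Finset.mem_range.1 hi).le))
    _ ≤ ∑ i ∈ Finset.range (k + 1), T.card ^ i * k.choose i :=
        Finset.sum_le_sum_of_subset (Finset.range_mono (Nat.le_succ k))
    _ = (T.card + 1) ^ k := by rw [add_pow]; simp

/-- `R` does not shatter any `k` points of `T` by elements of `S`. -/
def NotShattered {α β : Type*} (k : ℕ) (R : α → β → Prop) (S : Finset α) (T : Finset β) : Prop :=
  ¬ ∃ (x : Fin k → β) (y : Finset (Fin k) → α),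
    (∀ i, x i ∈ T) ∧ (∀ s, y s ∈ S) ∧ ∀ i s, R (y s) (x i) ↔ i ∈ s

/-- Sauer–Shelah: elements of `S` that are pairwise distinguished by points of `T`. -/
theorem card_le_of_distinguished {α β : Type*} {k : ℕ} {R : α → β → Prop}
    {S : Finset α} {T : Finset β} (hR : NotShattered k R S T)
    (hsep : ∀ a ∈ S, ∀ a' ∈ S, a ≠ a' → ∃ b ∈ T, ¬ (R a b ↔ R a' b)) :
    S.card ≤ (T.card + 1) ^ k := by
  classical
  set g : α → Finset β := fun a => T.filter fun b => R a b with hg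
  have hinj : Set.InjOn g S := by
    intro a ha a' ha' h
    by_contra hne
    obtain ⟨b, hb, hbne⟩ := hsep a ha a' ha' hne
    apply hbne
    have := congrArg (b ∈ ·) h
    simpa [hg, hb] using this
  rw [← Finset.card_image_of_injOn hinj]
  -- There are at most as many traces on `T` as sets shattered by them, and it remains to see that
  -- each shattered set has fewer than `k` points.
  refine (Finset.card_le_card_shatterer _).trans
    (le_trans (Finset.card_le_card ?_) (card_filter_powerset_card_lt_le T k))
  intro s hs
  rw [Finset.mem_shatterer] at hs
  have hsT : s ⊆ T := by
    obtain ⟨u, hu, hsu⟩ := hs.exists_superset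
    obtain ⟨a, -, rfl⟩ := Finset.mem_image.1 hu
    exact hsu.trans (Finset.filter_subset _ _)
  rw [Finset.mem_filter, Finset.mem_powerset]
  refine ⟨hsT, ?_⟩
  by_contra hlt
  push Not at hlt
  obtain ⟨s', hs's, hs'k⟩ := Finset.exists_subset_card_eq hlt
  have hs' := hs.mono_right hs's
  let e : Fin k ≃ s' := (Fintype.equivFinOfCardEq (by simpa using hs'k)).symm
  have hx : ∀ u : Finset (Fin k), ∃ a ∈ S, ∀ i, R a (e i) ↔ i ∈ u := by
    intro u
    obtain ⟨v, hv, hvu⟩ := hs' (t := u.map ⟨fun i => (e i : β), by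
      intro i j h; exact e.injective (Subtype.ext h)⟩) (by
        intro b hb
        obtain ⟨i, -, rfl⟩ := Finset.mem_map.1 hb
        exact (e i).2)
    obtain ⟨a, ha, rfl⟩ := Finset.mem_image.1 hv
    refine ⟨a, ha, fun i => ?_⟩
    have := congrArg ((e i : β) ∈ ·) hvu
    have hT : (e i : β) ∈ T := hsT (hs's (e i).2)
    simp only [hg, Finset.mem_inter, Finset.mem_filter, hT, true_and, (e i).2,
      Finset.mem_map, eq_iff_iff] at this
    rw [this]
    constructor
    · rintro ⟨j, hj, hji⟩
      rwa [← e.injective (Subtype.ext hji)]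
    · exact fun h => ⟨i, h, rfl⟩
  choose y hyS hy using hx
  exact hR ⟨fun i => e i, y, fun i => hsT (hs's (e i).2), hyS, fun i s => hy s i⟩

theorem NotShattered.mono {α β : Type*} {k : ℕ} {R : α → β → Prop}
    {S S' : Finset α} {T T' : Finset β} (hR : NotShattered k R S T) (hS : S' ⊆ S) (hT : T' ⊆ T) :
    NotShattered k R S' T' :=
  fun ⟨x, y, hx, hy, h⟩ => hR ⟨x, y, fun i => hT (hx i), fun s => hS (hy s), h⟩

open Classical in
/-- A separated family without shattered `k`-set is small. -/
theorem card_le_of_separated {α β : Type*} {k : ℕ} {R : α → β → Prop}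
    {S : Finset α} {T : Finset β} (hR : NotShattered k R S T) (hT : T.Nonempty) {q : ℝ}
    (hq1 : q ≤ 1)
    (hsep : ∀ a ∈ S, ∀ a' ∈ S, a ≠ a' →
      q * (T.card : ℝ) ≤ ((T.filter fun b => ¬ (R a b ↔ R a' b)).card : ℝ)) {t : ℕ}
    (ht : (((t : ℝ) + 1) ^ k + 1) ^ 2 * (1 - q) ^ t < 1) :
    S.card ≤ (t + 1) ^ k := by
  by_contra hlt
  push Not at hlt
  obtain ⟨S', hS', hc⟩ := Finset.exists_subset_card_eq (Nat.succ_le_of_lt hlt)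
  -- Hit the difference sets of all pairs from `(t + 1) ^ k + 1` elements. By `ht` fewer than one
  -- pair is missed, so `T'` distinguishes all of them, contradicting Sauer–Shelah on `T'`.
  obtain ⟨T', hT', hT'c, hhit⟩ := exists_hitting_set S'.offDiag T hT
    (fun p => T.filter fun b => ¬ (R p.1 b ↔ R p.2 b)) hq1 (by
      intro p hp
      rw [Finset.mem_offDiag] at hp
      rw [Finset.inter_eq_right.2 (Finset.filter_subset _ _)]
      exact hsep _ (hS' hp.1) _ (hS' hp.2.1) hp.2.2) t
  have hoff : (S'.offDiag.card : ℝ) ≤ (((t : ℝ) + 1) ^ k + 1) ^ 2 := by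
    have : S'.offDiag.card ≤ S'.card ^ 2 := by
      rw [Finset.offDiag_card, sq]; exact Nat.sub_le _ _
    rw [hc] at this
    exact_mod_cast this
  have hlt1 : ((S'.offDiag.filter fun i => ∀ w ∈ T', w ∉
      T.filter fun b => ¬ (R i.1 b ↔ R i.2 b)).card : ℝ) < 1 := by
    refine hhit.trans_lt (lt_of_le_of_lt ?_ ht)
    rw [mul_comm]
    exact mul_le_mul_of_nonneg_right hoff (pow_nonneg (by linarith) _)
  have h0 : (S'.offDiag.filter fun i => ∀ w ∈ T', w ∉
      T.filter fun b => ¬ (R i.1 b ↔ R i.2 b)) = ∅ := by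
    rw [← Finset.card_eq_zero]; exact Nat.lt_one_iff.1 (by exact_mod_cast hlt1)
  have := card_le_of_distinguished (hR.mono hS' hT') (by
    intro a ha a' ha' hne
    by_contra hcon
    push Not at hcon
    have : (a, a') ∈ (∅ : Finset (α × α)) := by
      rw [← h0, Finset.mem_filter]
      refine ⟨Finset.mem_offDiag.2 ⟨ha, ha', hne⟩, fun w hw hw' => ?_⟩
      exact (Finset.mem_filter.1 hw').2 (hcon w hw)
    simp at this)
  have h2 : (T'.card + 1) ^ k ≤ (t + 1) ^ k := Nat.pow_le_pow_left (by omega) k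
  omega

/-- `C` is a constant for which `card_le_of_separated` applies with a sample of size less than
`C / q ^ 2`. -/
def IsPackingConstant (k : ℕ) (C : ℝ) : Prop :=
  1 ≤ C ∧ ∀ q : ℝ, 0 < q → q ≤ 1 → ∃ t : ℕ, (t : ℝ) + 1 ≤ C / q ^ 2 ∧
      (((t : ℝ) + 1) ^ k + 1) ^ 2 * (1 - q) ^ t < 1

/-- A sample size of order `1 / q ^ 2` is used for simplicity: with `x = √t` one gets `q * t ≥ x`,
so `(1 - q) ^ t ≤ exp (-x)`, which beats a polynomial of degree `4 k` in `x` as soon as `x ≥ y`. -/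
theorem exists_isPackingConstant (k : ℕ) : ∃ C : ℝ, IsPackingConstant k C := by
  have hlim : Filter.Tendsto (fun x : ℝ => (4 * 4 ^ k) * (x ^ (4 * k) * Real.exp (-x)))
      Filter.atTop (nhds 0) := by
    simpa using (Real.tendsto_pow_mul_exp_neg_atTop_nhds_zero (4 * k)).const_mul (4 * 4 ^ k)
  obtain ⟨x₀, hx₀⟩ := Filter.eventually_atTop.1 (hlim.eventually (gt_mem_nhds one_pos))
  set y := max x₀ 1 with hy
  have hy1 : 1 ≤ y := le_max_right _ _
  -- The summand `2` absorbs the rounding and the `+ 1` in `t + 1`.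
  refine ⟨y ^ 2 + 2, by nlinarith, fun q hq hq1 => ⟨⌈y ^ 2 / q ^ 2⌉₊, ?_, ?_⟩⟩
  · have h1 := Nat.ceil_lt_add_one (show 0 ≤ y ^ 2 / q ^ 2 by positivity)
    have h2 : 2 ≤ 2 / q ^ 2 := by
      rw [le_div_iff₀ (by positivity)]; nlinarith
    rw [add_div]; linarith
  · set t := ⌈y ^ 2 / q ^ 2⌉₊ with ht
    have h1 : y ^ 2 / q ^ 2 ≤ t := Nat.le_ceil _
    have ht1 : (1 : ℝ) ≤ t := by
      refine le_trans ?_ h1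
      rw [le_div_iff₀ (by positivity)]; nlinarith
    set x := Real.sqrt t with hx
    have hxx : x ^ 2 = t := Real.sq_sqrt (by linarith)
    have hx0 : 0 ≤ x := Real.sqrt_nonneg _
    have hyx : y / q ≤ x := by
      apply Real.le_sqrt_of_sq_le; rwa [div_pow]
    have hqx : y ≤ q * x := by rwa [div_le_iff₀' hq] at hyx
    have hxy : y ≤ x := by nlinarith
    have hexp : (1 - q) ^ t ≤ Real.exp (-x) := by
      calc (1 - q) ^ t ≤ Real.exp (-q) ^ t := by
            apply pow_le_pow_left₀ (by linarith)
            have := Real.add_one_le_exp (-q); linarith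
        _ = Real.exp (t * (-q)) := by rw [← Real.exp_nat_mul]
        _ ≤ Real.exp (-x) := by
            apply Real.exp_le_exp.2
            rw [← hxx]; nlinarith
    have hpoly : (((t : ℝ) + 1) ^ k + 1) ^ 2 ≤ 4 * 4 ^ k * x ^ (4 * k) := by
      have h3 : ((t : ℝ) + 1) ^ k ≤ (2 * x ^ 2) ^ k := by
        apply pow_le_pow_left₀ (by positivity); rw [hxx]; linarith
      have h4 : 1 ≤ (2 * x ^ 2) ^ k := one_le_pow₀ (by rw [hxx]; linarith)
      calc (((t : ℝ) + 1) ^ k + 1) ^ 2 ≤ (2 * (2 * x ^ 2) ^ k) ^ 2 := by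
            apply pow_le_pow_left₀ (by positivity); linarith
        _ = 4 * 4 ^ k * x ^ (4 * k) := by
            rw [mul_pow, mul_pow, mul_pow, ← pow_mul, ← pow_mul, ← pow_mul, mul_comm k 2, pow_mul]
            norm_num
            ring
    calc _ ≤ 4 * 4 ^ k * x ^ (4 * k) * Real.exp (-x) :=
          mul_le_mul hpoly hexp (pow_nonneg (by linarith) _) (by positivity)
      _ = (4 * 4 ^ k) * (x ^ (4 * k) * Real.exp (-x)) := by ring
      _ < 1 := hx₀ x ((le_max_left _ _).trans hxy)

-- A weak form of Haussler's packing lemma: the sample size enters the Sauer–Shelah bound, which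
-- gives exponent `2 k` in `1 / q`.
open Classical in
theorem IsPackingConstant.card_le {k : ℕ} {C : ℝ} (hC : IsPackingConstant k C) {α β : Type*}
    {R : α → β → Prop}
    {S : Finset α} {T : Finset β} (hR : NotShattered k R S T) (hT : T.Nonempty) {q : ℝ}
    (hq : 0 < q) (hq1 : q ≤ 1)
    (hsep : ∀ a ∈ S, ∀ a' ∈ S, a ≠ a' →
      q * (T.card : ℝ) ≤ ((T.filter fun b => ¬ (R a b ↔ R a' b)).card : ℝ)) :
    (S.card : ℝ) ≤ (C / q ^ 2) ^ k := by
  obtain ⟨t, ht, ht'⟩ := hC.2 q hq hq1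
  have h1 : (S.card : ℝ) ≤ ((t : ℝ) + 1) ^ k := by
    exact_mod_cast card_le_of_separated hR hT hq1 hsep ht'
  exact h1.trans (pow_le_pow_left₀ (by positivity) ht k)

/-! ### Clustering the vertices of an edge-colored bipartite graph -/

namespace ColoredBipartite

variable {A B : Type*}

/-- The points on which `a` and `a'` take the colors `0` and `1`, in some order. -/
def diffSet [Fintype B] (G : ColoredBipartite A B) (a a' : A) : Finset B :=
  Finset.univ.filter fun b =>
    (G.color a b = 0 ∧ G.color a' b = 1) ∨ (G.color a b = 1 ∧ G.color a' b = 0)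

theorem mem_diffSet [Fintype B] {G : ColoredBipartite A B} {a a' : A} {b : B} :
    b ∈ G.diffSet a a' ↔
      (G.color a b = 0 ∧ G.color a' b = 1) ∨ (G.color a b = 1 ∧ G.color a' b = 0) := by
  simp [diffSet]

theorem diffSet_self [Fintype B] (G : ColoredBipartite A B) (a : A) : G.diffSet a a = ∅ := by
  ext b
  simp only [mem_diffSet, Finset.notMem_empty, iff_false]
  rintro (⟨h, h'⟩ | ⟨h, h'⟩) <;> simp [h] at h'

theorem mem_nbhdLeft [Fintype B] {G : ColoredBipartite A B} {u : Fin 3} {a : A} {b : B} :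
    b ∈ G.nbhdLeft u a ↔ G.color a b = u := by
  simp [nbhdLeft]

/-- A triangle inequality: where `s` has color `0` or `1`, it cannot agree with both `a` and `a'` if
these take opposite colors. Only color `2` at the middle vertex `s` does harm. -/
theorem diffSet_subset [Fintype B] [DecidableEq B] (G : ColoredBipartite A B) (a a' s : A) :
    G.diffSet a a' ⊆ G.diffSet a s ∪ G.diffSet a' s ∪ G.nbhdLeft 2 s := by
  intro b
  simp only [mem_diffSet, Finset.mem_union, mem_nbhdLeft]
  generalize G.color a b = u
  generalize G.color a' b = v
  generalize G.color s b = w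
  revert u v w
  decide

open Classical in
/-- Separated sets of elements with few edges of color `2` are small. -/
theorem card_le_of_diffSet_separated [Fintype B] {k : ℕ} {C : ℝ}
    (hC : IsPackingConstant k C) (G : ColoredBipartite A B) (hG : ¬ G.HasCopy 0 1 k)
    {q ρ : ℝ} (hq : 0 < q) (hq1 : q ≤ 1) {M : ℕ} (hM : (C / (q / 2) ^ 2) ^ k < (M : ℝ) + 1)
    (hρ : ((M : ℝ) + 1) * ρ ≤ q / 2) (S : Finset A)
    (hS : ∀ a ∈ S, ((G.nbhdLeft 2 a).card : ℝ) ≤ ρ * Fintype.card B)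
    (hsep : ∀ a ∈ S, ∀ a' ∈ S, a ≠ a' →
      q * (Fintype.card B : ℝ) < ((G.diffSet a a').card : ℝ)) : S.card ≤ M := by
  -- For empty `B` strict separation is impossible, so `S` has at most one element; the packing
  -- bound needs a nonempty ground set.
  rcases isEmpty_or_nonempty B with hB | hB
  · have : S.card ≤ 1 := by
      rw [Finset.card_le_one]
      intro a ha a' ha'
      by_contra hne
      have := hsep a ha a' ha' hne
      have h0 : G.diffSet a a' = ∅ := Finset.eq_empty_of_isEmpty _
      simp [h0] at this
    have hM1 : 1 ≤ M := by
      have h1 : (1 : ℝ) ≤ (C / (q / 2) ^ 2) ^ k := by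
        apply one_le_pow₀
        rw [le_div_iff₀ (by positivity)]
        have := hC.1
        nlinarith
      have : (0 : ℝ) < M := by linarith
      exact_mod_cast this
    omega
  by_contra hlt
  push Not at hlt
  obtain ⟨S', hS', hc⟩ := Finset.exists_subset_card_eq (Nat.succ_le_of_lt hlt)
  -- Delete every point where one of the `M + 1` chosen vertices has color `2`. This loses at most a
  -- `q / 2`-fraction of `B`; on the rest only colors `0` and `1` occur and the family remains `q /
  -- 2`-separated.
  set Z := S'.biUnion fun a => G.nbhdLeft 2 a with hZ
  set T : Finset B := Finset.univ \ Z with hT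
  have hBpos : (0 : ℝ) < Fintype.card B := by exact_mod_cast Fintype.card_pos
  have hZc : (Z.card : ℝ) ≤ q / 2 * Fintype.card B := by
    calc (Z.card : ℝ) ≤ ∑ a ∈ S', ((G.nbhdLeft 2 a).card : ℝ) := by
          exact_mod_cast Finset.card_biUnion_le
      _ ≤ ∑ a ∈ S', ρ * Fintype.card B := Finset.sum_le_sum fun a ha => hS a (hS' ha)
      _ = ((M : ℝ) + 1) * ρ * Fintype.card B := by
          rw [Finset.sum_const, hc, nsmul_eq_mul]; push_cast; ring
      _ ≤ _ := by gcongr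
  have hTne : T.Nonempty := by
    rw [← Finset.card_pos, hT, Finset.card_sdiff_of_subset (Finset.subset_univ _), Finset.card_univ]
    apply Nat.sub_pos_of_lt
    have : (Z.card : ℝ) < Fintype.card B := by nlinarith
    exact_mod_cast this
  have hcol : ∀ a ∈ S', ∀ b ∈ T, G.color a b ≠ 0 → G.color a b = 1 := by
    intro a ha b hb h0
    have h2 : G.color a b ≠ 2 := by
      intro h2
      rw [hT, Finset.mem_sdiff] at hb
      exact hb.2 (Finset.mem_biUnion.2 ⟨a, ha, mem_nbhdLeft.2 h2⟩)
    revert h0 h2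
    generalize G.color a b = u
    revert u
    decide
  have hR : NotShattered k (fun a b => G.color a b = 0) S' T := by
    rintro ⟨x, y, hx, hy, h⟩
    refine hG (Or.inr ⟨x, y, fun i s => ⟨(h i s).2, fun hi => ?_⟩⟩)
    exact hcol _ (hy s) _ (hx i) (fun h0 => hi ((h i s).1 h0))
  have hle := hC.card_le hR hTne (half_pos hq) (by linarith) (by
    intro a ha a' ha' hne
    have h1 := hsep a (hS' ha) a' (hS' ha') hne
    have h2 : G.diffSet a a' ⊆
        (T.filter fun b => ¬ (G.color a b = 0 ↔ G.color a' b = 0)) ∪ Z := by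
      intro b hb
      by_cases hbZ : b ∈ Z
      · exact Finset.mem_union_right _ hbZ
      · apply Finset.mem_union_left
        rw [Finset.mem_filter]
        refine ⟨by simp [hT, hbZ], ?_⟩
        rw [mem_diffSet] at hb
        rcases hb with ⟨h, h'⟩ | ⟨h, h'⟩ <;> simp [h, h']
    have h3 : ((G.diffSet a a').card : ℝ) ≤
        ((T.filter fun b => ¬ (G.color a b = 0 ↔ G.color a' b = 0)).card : ℝ) + Z.card := by
      exact_mod_cast (Finset.card_le_card h2).trans (Finset.card_union_le _ _)
    have h4 : (T.card : ℝ) ≤ Fintype.card B := by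
      exact_mod_cast Finset.card_le_univ T
    have h5 : q / 2 * (T.card : ℝ) ≤ q / 2 * Fintype.card B := by gcongr
    have h6 : q / 2 * (T.card : ℝ) ≤
        ((T.filter fun b => ¬ (G.color a b = 0 ↔ G.color a' b = 0)).card : ℝ) := by linarith
    convert h6)
  rw [hc] at hle
  push_cast at hle
  linarith

/-- Elements with few edges of color `2` fall into few clusters of small diameter. -/
theorem exists_clustering [Fintype A] [Fintype B] {k : ℕ} {C : ℝ}
    (hC : IsPackingConstant k C) (G : ColoredBipartite A B) (hG : ¬ G.HasCopy 0 1 k)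
    {q ρ : ℝ} (hq : 0 < q) (hq1 : q ≤ 1) (hρ0 : 0 ≤ ρ)
    {M : ℕ} (hM : (C / (q / 2) ^ 2) ^ k < (M : ℝ) + 1) (hρ : ((M : ℝ) + 1) * ρ ≤ q / 2) :
    ∃ f : A → Fin (M + 1), ∀ a a', f a = f a' →
      ((G.nbhdLeft 2 a).card : ℝ) ≤ ρ * Fintype.card B →
      ((G.nbhdLeft 2 a').card : ℝ) ≤ ρ * Fintype.card B →
      ((G.diffSet a a').card : ℝ) ≤ 3 * q * Fintype.card B := by
  classical
  set Good : A → Prop := fun a => ((G.nbhdLeft 2 a).card : ℝ) ≤ ρ * Fintype.card B with hGood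
  set Sep : Finset A → Prop := fun S => (∀ a ∈ S, Good a) ∧ ∀ a ∈ S, ∀ a' ∈ S, a ≠ a' →
      q * (Fintype.card B : ℝ) < ((G.diffSet a a').card : ℝ) with hSep
  -- A largest separated family of vertices of small color-`2` degree is a `q`-net for all such
  -- vertices.
  obtain ⟨S, hS, hmax⟩ := Finset.exists_max_image
    ((Finset.univ : Finset (Finset A)).filter Sep) Finset.card ⟨∅, by simp [hSep]⟩
  have hS' : Sep S := (Finset.mem_filter.1 hS).2
  have hcard := card_le_of_diffSet_separated hC G hG hq hq1 hM hρ S hS'.1 hS'.2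
  have hcomm : ∀ a a', G.diffSet a a' = G.diffSet a' a := by
    intro a a'; ext b; simp only [mem_diffSet]; tauto
  have hcenter : ∀ a, ∃ s, Good a → s ∈ S ∧
      ((G.diffSet a s).card : ℝ) ≤ q * Fintype.card B := by
    intro a
    by_cases ha : Good a
    swap
    · exact ⟨a, fun h => absurd h ha⟩
    by_cases haS : a ∈ S
    · exact ⟨a, fun _ => ⟨haS, by rw [diffSet_self]; simp; positivity⟩⟩
    by_contra hcon
    push Not at hcon
    have hcon' : ∀ s ∈ S, q * Fintype.card B < ((G.diffSet a s).card : ℝ) :=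
      fun s hs => (hcon s).2 hs
    have : Sep (insert a S) := by
      refine ⟨fun b hb => ?_, fun b hb b' hb' hne => ?_⟩
      · rcases Finset.mem_insert.1 hb with rfl | hb
        · exact ha
        · exact hS'.1 b hb
      · rcases Finset.mem_insert.1 hb with h | h <;>
          rcases Finset.mem_insert.1 hb' with h' | h'
        · exact absurd (h.trans h'.symm) hne
        · rw [h]; exact hcon' _ h'
        · rw [h', hcomm]; exact hcon' _ h
        · exact hS'.2 b h b' h' hne
    have := hmax (insert a S) (by simpa using this)
    rw [Finset.card_insert_of_notMem haS] at this
    omega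
  choose g hg using hcenter
  let e : S ≃ Fin S.card := S.equivFin
  -- The codomain `Fin (M + 1)` is nonempty even if `S` is empty; vertices whose `g a` is not in `S`
  -- receive the default class `0`, about which nothing needs to be proved.
  refine ⟨fun a => if h : g a ∈ S then Fin.castLE (by omega) (e ⟨g a, h⟩) else 0, ?_⟩
  intro a a' hff ha ha'
  have h1 := hg a ha
  have h2 := hg a' ha'
  simp only [h1.1, h2.1, dif_pos] at hff
  have heq : g a = g a' := by
    have := e.injective (Fin.castLE_injective _ hff)
    exact congrArg Subtype.val this
  -- The factor `3`: one `q` for each distance to the common center and `ρ ≤ q` for the edges of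
  -- color `2` at the center.
  have h3 : ((G.diffSet a a').card : ℝ) ≤ (G.diffSet a (g a)).card + (G.diffSet a' (g a)).card
      + (G.nbhdLeft 2 (g a)).card := by
    exact_mod_cast (Finset.card_le_card (G.diffSet_subset a a' (g a))).trans
      ((Finset.card_union_le _ _).trans
        (Nat.add_le_add_right (Finset.card_union_le _ _) _))
  have h4 := hS'.1 _ h1.1
  have h5 : ρ * Fintype.card B ≤ q * Fintype.card B := by
    apply mul_le_mul_of_nonneg_right _ (by positivity)
    have : 0 ≤ (M : ℝ) * ρ := by positivity
    linarith
  have h6 := h2.2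
  rw [← heq] at h6
  simp only [hGood] at h4
  linarith [h1.2]

/-- The edge-colored graph with the two vertex classes exchanged. -/
def swap (G : ColoredBipartite A B) : ColoredBipartite B A := ⟨fun b a => G.color a b⟩

theorem hasCopy_swap {G : ColoredBipartite A B} {u v : Fin 3} {k : ℕ} :
    G.swap.HasCopy u v k ↔ G.HasCopy u v k := Or.comm

end ColoredBipartite

/-! ### Fiber partitions, homogeneous pairs and removal constants -/

/-- The partition of `X` into the nonempty fibers of `f`. -/
def fiberPartition {α ι : Type*} [DecidableEq α] [DecidableEq ι] (X : Finset α) (f : α → ι) :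
    Finpartition X :=
  haveI : DecidableRel (Setoid.ker f).r := fun a b => decEq (f a) (f b)
  Finpartition.ofSetSetoid (Setoid.ker f) X

theorem mem_fiberPartition {α ι : Type*} [DecidableEq α] [DecidableEq ι] {X : Finset α}
    {f : α → ι} {S : Finset α} :
    S ∈ (fiberPartition X f).parts ↔ ∃ a ∈ X, (X.filter fun b => f b = f a) = S := by
  simp only [fiberPartition, Finpartition.ofSetSetoid, Finset.mem_image]
  refine exists_congr fun a => and_congr_right fun _ => ?_
  simp [eq_comm (a := f a)]

theorem card_fiberPartition_le {α ι : Type*} [DecidableEq α] [DecidableEq ι] [Fintype ι]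
    (X : Finset α) (f : α → ι) : (fiberPartition X f).parts.card ≤ Fintype.card ι := by
  have h : (fiberPartition X f).parts ⊆
      (Finset.univ : Finset ι).image fun i => X.filter fun b => f b = i := by
    intro S hS
    obtain ⟨a, -, rfl⟩ := mem_fiberPartition.1 hS
    exact Finset.mem_image.2 ⟨f a, Finset.mem_univ _, rfl⟩
  exact (Finset.card_le_card h).trans Finset.card_image_le

theorem sum_card_inter_fiber {α ι : Type*} [Fintype α] [DecidableEq α] [Fintype ι]
    [DecidableEq ι] (Z : Finset α) (f : α → ι) :
    ∑ i, ((Z ∩ Finset.univ.filter fun a => f a = i).card : ℝ) = Z.card := by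
  have h := Finset.card_eq_sum_card_fiberwise (f := f) (s := Z) (t := Finset.univ) (by simp)
  rw [h]
  push_cast
  refine Finset.sum_congr rfl fun i _ => ?_
  congr 2
  ext a
  simp

/-- If neither of two colors covers a fraction `1 - η`, then either the third color is frequent
or both of them are. -/
theorem weight_le_of_not_homogeneous {η N n₀ n₁ n₂ : ℝ} (hη : 0 < η) (h₀ : 0 ≤ n₀) (h₁ : 0 ≤ n₁)
    (h₂ : 0 ≤ n₂) (hN : n₀ + n₁ + n₂ = N) (h₀' : n₀ < (1 - η) * N) (h₁' : n₁ < (1 - η) * N) :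
    η * N * N ≤ 2 * n₂ * N + 8 * (n₀ * n₁) := by
  have hN0 : 0 ≤ N := by linarith
  have hη1 : η < 1 := by
    by_contra h
    push Not at h
    nlinarith
  by_cases hn : η / 2 * N ≤ n₂
  · nlinarith [mul_nonneg h₀ h₁]
  -- With the third color below `η * N / 2`, both `n₀` and `n₁` are at least `η * N / 2`, and the
  -- larger is at least `N / 4`.
  push Not at hn
  have ha : η / 2 * N ≤ n₀ := by linarith
  have hb : η / 2 * N ≤ n₁ := by linarith
  have hs : N / 2 ≤ n₀ + n₁ := by nlinarith
  have hmul : 0 ≤ n₂ * N := by positivity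
  rcases le_total n₀ n₁ with h | h
  · have : N / 4 ≤ n₁ := by linarith
    have : η / 2 * N * (N / 4) ≤ n₀ * n₁ := mul_le_mul ha this (by positivity) h₀
    linarith
  · have : N / 4 ≤ n₀ := by linarith
    have : N / 4 * (η / 2 * N) ≤ n₀ * n₁ := mul_le_mul this hb (by positivity) h₀
    linarith

namespace ColoredBipartite

variable {A B : Type*} [Fintype B] [DecidableEq B]

/-- The total size of the sets `diffSet a a'` within `Y`, for `a` and `a'` in `X`. -/
def diffCount (G : ColoredBipartite A B) (X : Finset A) (Y : Finset B) : ℝ :=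
  ∑ a ∈ X, ∑ a' ∈ X, ((G.diffSet a a' ∩ Y).card : ℝ)

theorem diffCount_nonneg (G : ColoredBipartite A B) (X : Finset A) (Y : Finset B) :
    0 ≤ G.diffCount X Y := by
  unfold diffCount; positivity

theorem sum_diffCount_fiber {ι : Type*} [Fintype ι] [DecidableEq ι] (G : ColoredBipartite A B)
    (X : Finset A) (g : B → ι) :
    ∑ j, G.diffCount X (Finset.univ.filter fun b => g b = j) = G.diffCount X Finset.univ := by
  unfold diffCount
  rw [Finset.sum_comm]
  refine Finset.sum_congr rfl fun a _ => ?_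
  rw [Finset.sum_comm]
  refine Finset.sum_congr rfl fun a' _ => ?_
  rw [sum_card_inter_fiber, Finset.inter_univ]

variable [Fintype A] [DecidableEq A]

theorem card_edgeClass_inter (G : ColoredBipartite A B) (u : Fin 3) (X : Finset A) (Y : Finset B) :
    ((G.edgeClass u ∩ X ×ˢ Y).card : ℝ) =
      ∑ a ∈ X, ∑ b ∈ Y, if G.color a b = u then (1 : ℝ) else 0 := by
  rw [← Finset.sum_product' X Y (fun a b => if G.color a b = u then (1 : ℝ) else 0),
    Finset.sum_boole]
  congr 2
  ext p
  simp [edgeClass, and_comm]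

theorem card_edgeClass_inter_add (G : ColoredBipartite A B) (X : Finset A) (Y : Finset B) :
    ((G.edgeClass 0 ∩ X ×ˢ Y).card : ℝ) + ((G.edgeClass 1 ∩ X ×ˢ Y).card : ℝ) +
      ((G.edgeClass 2 ∩ X ×ˢ Y).card : ℝ) = X.card * Y.card := by
  simp only [card_edgeClass_inter, ← Finset.sum_add_distrib]
  have : ∀ a ∈ X, ∀ b ∈ Y, (((if G.color a b = 0 then (1 : ℝ) else 0) +
      if G.color a b = 1 then (1 : ℝ) else 0) + if G.color a b = 2 then (1 : ℝ) else 0) = 1 := by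
    intro a _ b _
    generalize G.color a b = u
    fin_cases u <;> simp
  rw [Finset.sum_congr rfl fun a ha => Finset.sum_congr rfl (this a ha)]
  simp

/-- Exchange argument: given `(a, b)` of color `0` and `(a', b')` of color `1`, look at `(a', b)`.
Color `1` there makes `a`, `a'` differ at `b`; color `0` makes `b`, `b'` differ at `a'`; color `2`
is counted by the last term. The factors come from the variables that remain free. -/
theorem card_mul_card_le (G : ColoredBipartite A B) (X : Finset A) (Y : Finset B) :
    ((G.edgeClass 0 ∩ X ×ˢ Y).card : ℝ) * ((G.edgeClass 1 ∩ X ×ˢ Y).card : ℝ) ≤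
      Y.card * G.diffCount X Y + X.card * G.swap.diffCount Y X +
        X.card * Y.card * ((G.edgeClass 2 ∩ X ×ˢ Y).card : ℝ) := by
  have key : ∀ a a' b b', (if G.color a b = 0 then (1 : ℝ) else 0) *
      (if G.color a' b' = 1 then (1 : ℝ) else 0) ≤
      (if b ∈ G.diffSet a a' then (1 : ℝ) else 0) +
      (if a' ∈ G.swap.diffSet b b' then (1 : ℝ) else 0) +
      (if G.color a' b = 2 then (1 : ℝ) else 0) := by
    intro a a' b b'
    simp only [mem_diffSet, swap]
    generalize G.color a b = u
    generalize G.color a' b = v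
    generalize G.color a' b' = w
    fin_cases u <;> fin_cases v <;> fin_cases w <;> simp
  have hA : G.diffCount X Y = ∑ a ∈ X, ∑ b ∈ Y, ∑ a' ∈ X,
      if b ∈ G.diffSet a a' then (1 : ℝ) else 0 := by
    unfold diffCount
    refine Finset.sum_congr rfl fun a _ => ?_
    rw [Finset.sum_comm]
    refine Finset.sum_congr rfl fun a' _ => ?_
    rw [Finset.sum_boole, Finset.filter_mem_eq_inter, Finset.inter_comm]
  have hB : G.swap.diffCount Y X = ∑ b ∈ Y, ∑ a' ∈ X, ∑ b' ∈ Y,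
      if a' ∈ G.swap.diffSet b b' then (1 : ℝ) else 0 := by
    unfold diffCount
    refine Finset.sum_congr rfl fun b _ => ?_
    rw [Finset.sum_comm]
    refine Finset.sum_congr rfl fun b' _ => ?_
    rw [Finset.sum_boole, Finset.filter_mem_eq_inter, Finset.inter_comm]
  calc _ = ∑ a ∈ X, ∑ b ∈ Y, ∑ a' ∈ X, ∑ b' ∈ Y, (if G.color a b = 0 then (1 : ℝ) else 0) *
      (if G.color a' b' = 1 then (1 : ℝ) else 0) := by
        simp only [card_edgeClass_inter, Finset.sum_mul]
        simp only [Finset.mul_sum]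
    _ ≤ ∑ a ∈ X, ∑ b ∈ Y, ∑ a' ∈ X, ∑ b' ∈ Y, ((if b ∈ G.diffSet a a' then (1 : ℝ) else 0) +
      (if a' ∈ G.swap.diffSet b b' then (1 : ℝ) else 0) +
      (if G.color a' b = 2 then (1 : ℝ) else 0)) :=
        Finset.sum_le_sum fun a _ => Finset.sum_le_sum fun b _ => Finset.sum_le_sum fun a' _ =>
          Finset.sum_le_sum fun b' _ => key a a' b b'
    _ = _ := by
        rw [hA, hB, card_edgeClass_inter, Finset.sum_comm (s := X) (t := Y) (f := fun a b =>
          if G.color a b = 2 then (1 : ℝ) else 0)]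
        simp only [Finset.sum_add_distrib, Finset.sum_const, nsmul_eq_mul, ← Finset.mul_sum]
        ring

/-- Clusters of small diameter have small average `diffCount`. -/
theorem sum_diffCount_div_le {ι : Type*} [Fintype ι] [DecidableEq ι] (G : ColoredBipartite A B)
    (f : A → ι) {q ρ : ℝ} (hρ : 0 < ρ) (hq : 0 ≤ q)
    (hE : ((G.edgeClass 2).card : ℝ) ≤ ρ ^ 2 * Fintype.card A * Fintype.card B)
    (hf : ∀ a a', f a = f a' →
      ((G.nbhdLeft 2 a).card : ℝ) ≤ ρ * Fintype.card B →
      ((G.nbhdLeft 2 a').card : ℝ) ≤ ρ * Fintype.card B →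
      ((G.diffSet a a').card : ℝ) ≤ 3 * q * Fintype.card B) :
    ∑ i, G.diffCount (Finset.univ.filter fun a => f a = i) Finset.univ /
        ((Finset.univ.filter fun a => f a = i).card : ℝ) ≤
      (3 * q + 2 * ρ) * (Fintype.card A * Fintype.card B) := by
  classical
  set Bad : A → Prop := fun a => ¬ ((G.nbhdLeft 2 a).card : ℝ) ≤ ρ * Fintype.card B with hBad
  set n : ℝ := (Fintype.card B : ℝ) with hn
  have hn0 : 0 ≤ n := by positivity
  -- Markov: edge density `ρ ^ 2` in color `2` leaves at most a `ρ`-fraction of vertices with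
  -- color-`2` degree above `ρ * n`. Pairs involving such vertices are bounded trivially by `n`.
  have hsumBad : ∑ a, (if Bad a then (1 : ℝ) else 0) * n ≤ ρ * (Fintype.card A * n) := by
    have h1 : ((G.edgeClass 2).card : ℝ) = ∑ a, ((G.nbhdLeft 2 a).card : ℝ) := by
      have := G.card_edgeClass_inter 2 Finset.univ Finset.univ
      rw [Finset.univ_product_univ, Finset.inter_univ] at this
      rw [this]
      refine Finset.sum_congr rfl fun a _ => ?_
      rw [Finset.sum_boole]; rfl
    have h2 : ∀ a, ρ * ((if Bad a then (1 : ℝ) else 0) * n) ≤ ((G.nbhdLeft 2 a).card : ℝ) := by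
      intro a
      split_ifs with h
      · simp only [hBad, not_le] at h; linarith
      · simp
    have h3 : ρ * ∑ a, (if Bad a then (1 : ℝ) else 0) * n ≤ ρ * (ρ * (Fintype.card A * n)) := by
      rw [Finset.mul_sum]
      refine (Finset.sum_le_sum fun a _ => h2 a).trans ?_
      rw [← h1]; refine hE.trans (le_of_eq ?_); ring
    exact le_of_mul_le_mul_left h3 hρ
  have hdiff : ∀ a a', f a = f a' → ((G.diffSet a a').card : ℝ) ≤ 3 * q * n +
      (if Bad a then (1 : ℝ) else 0) * n + (if Bad a' then (1 : ℝ) else 0) * n := by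
    intro a a' h
    have hle : ((G.diffSet a a').card : ℝ) ≤ n := by
      rw [hn]; exact_mod_cast Finset.card_le_univ (G.diffSet a a')
    have h3 : 0 ≤ 3 * q * n := by positivity
    by_cases ha : Bad a
    · rw [if_pos ha]
      have : 0 ≤ (if Bad a' then (1 : ℝ) else 0) * n := by split_ifs <;> simp [hn0]
      linarith
    by_cases ha' : Bad a'
    · rw [if_pos ha', if_neg ha]; linarith
    rw [if_neg ha, if_neg ha']
    simp only [hBad, not_not] at ha ha'
    linarith [hf a a' h ha ha']
  have hcell : ∀ i, G.diffCount (Finset.univ.filter fun a => f a = i) Finset.univ /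
        ((Finset.univ.filter fun a => f a = i).card : ℝ) ≤
      ∑ a ∈ Finset.univ.filter fun a => f a = i,
        (3 * q * n + 2 * ((if Bad a then (1 : ℝ) else 0) * n)) := by
    intro i
    set X := Finset.univ.filter fun a => f a = i with hX
    rcases X.eq_empty_or_nonempty with h0 | h0
    · simp [h0]
    rw [div_le_iff₀ (by exact_mod_cast h0.card_pos)]
    calc G.diffCount X Finset.univ ≤ ∑ a ∈ X, ∑ a' ∈ X, (3 * q * n +
      (if Bad a then (1 : ℝ) else 0) * n + (if Bad a' then (1 : ℝ) else 0) * n) := by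
          unfold diffCount
          refine Finset.sum_le_sum fun a ha => Finset.sum_le_sum fun a' ha' => ?_
          rw [Finset.inter_univ]
          apply hdiff
          rw [(Finset.mem_filter.1 ha).2, (Finset.mem_filter.1 ha').2]
      _ = _ := by
          simp only [Finset.sum_add_distrib, Finset.sum_const, nsmul_eq_mul, ← Finset.mul_sum]
          ring
  calc _ ≤ ∑ i, ∑ a ∈ Finset.univ.filter fun a => f a = i,
        (3 * q * n + 2 * ((if Bad a then (1 : ℝ) else 0) * n)) :=
        Finset.sum_le_sum fun i _ => hcell i
    _ = ∑ a, (3 * q * n + 2 * ((if Bad a then (1 : ℝ) else 0) * n)) :=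
        Finset.sum_fiberwise _ _ _
    _ ≤ _ := by
        rw [Finset.sum_add_distrib, ← Finset.mul_sum Finset.univ _ 2, Finset.sum_const,
          nsmul_eq_mul, Finset.card_univ]
        linarith

theorem sum_card_edgeClass_fiber {ι κ : Type*} [Fintype ι] [DecidableEq ι] [Fintype κ]
    [DecidableEq κ] (G : ColoredBipartite A B) (u : Fin 3) (f : A → ι) (g : B → κ) :
    ∑ i, ∑ j, ((G.edgeClass u ∩ (Finset.univ.filter fun a => f a = i) ×ˢ
      (Finset.univ.filter fun b => g b = j)).card : ℝ) = (G.edgeClass u).card := by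
  rw [← sum_card_inter_fiber (G.edgeClass u) (fun p => (f p.1, g p.2)), Fintype.sum_prod_type]
  refine Finset.sum_congr rfl fun i _ => Finset.sum_congr rfl fun j _ => ?_
  congr 2
  ext p
  simp

/-- The contribution of a pair of cells that is not homogeneous. -/
theorem weight_le_of_not_homogeneous_cell (G : ColoredBipartite A B) {X : Finset A} {Y : Finset B}
    {η : ℝ} (hη : 0 < η)
    (h0 : ((G.edgeClass 0 ∩ X ×ˢ Y).card : ℝ) < (1 - η) * (X.card : ℝ) * (Y.card : ℝ))
    (h1 : ((G.edgeClass 1 ∩ X ×ˢ Y).card : ℝ) < (1 - η) * (X.card : ℝ) * (Y.card : ℝ)) :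
    η * (X.card * Y.card : ℝ) ≤ 10 * ((G.edgeClass 2 ∩ X ×ˢ Y).card : ℝ) +
      8 * (G.diffCount X Y / X.card) + 8 * (G.swap.diffCount Y X / Y.card) := by
  rw [mul_assoc] at h0 h1
  have hs := G.card_edgeClass_inter_add X Y
  have hw := weight_le_of_not_homogeneous hη (Nat.cast_nonneg _) (Nat.cast_nonneg _)
    (Nat.cast_nonneg _) hs h0 h1
  have hm := G.card_mul_card_le X Y
  have hN : (0 : ℝ) < X.card * Y.card := by
    rcases (show (0 : ℝ) ≤ X.card * Y.card by positivity).lt_or_eq with h | h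
    · exact h
    · rw [← h, mul_zero] at h0
      exact absurd h0 (not_lt.2 (Nat.cast_nonneg _))
  have hx : (0 : ℝ) < X.card := by
    rcases Nat.eq_zero_or_pos X.card with h | h
    · rw [h] at hN; simp at hN
    · exact_mod_cast h
  have hy : (0 : ℝ) < Y.card := by
    rcases Nat.eq_zero_or_pos Y.card with h | h
    · rw [h] at hN; simp at hN
    · exact_mod_cast h
  refine le_of_mul_le_mul_right ?_ hN
  refine hw.trans ?_
  -- The coefficient `10` is `2` from `weight_le_of_not_homogeneous` plus `8` times the color-`2`
  -- term of `card_mul_card_le`.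
  have e1 : (10 * ((G.edgeClass 2 ∩ X ×ˢ Y).card : ℝ) +
    8 * (G.diffCount X Y / X.card) +
    8 * (G.swap.diffCount Y X / Y.card)) * (X.card * Y.card) =
    10 * ((G.edgeClass 2 ∩ X ×ˢ Y).card : ℝ) * (X.card * Y.card) +
    8 * (G.diffCount X Y * Y.card) +
    8 * (G.swap.diffCount Y X * X.card) := by
    field_simp
  rw [e1]
  linarith

/-- Clusterings of small diameter on both sides give a homogeneous pair of partitions. -/
theorem isHomogeneous_fiberPartition {ι κ : Type*} [Fintype ι] [DecidableEq ι] [Fintype κ]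
    [DecidableEq κ] (G : ColoredBipartite A B)
    (f : A → ι) (g : B → κ) {η e dA dB : ℝ} (hη : 0 < η)
    (hE : ((G.edgeClass 2).card : ℝ) ≤ e * (Fintype.card A * Fintype.card B))
    (hA : ∑ i, G.diffCount (Finset.univ.filter fun a => f a = i) Finset.univ /
        ((Finset.univ.filter fun a => f a = i).card : ℝ) ≤ dA * (Fintype.card A * Fintype.card B))
    (hB : ∑ j, G.swap.diffCount (Finset.univ.filter fun b => g b = j) Finset.univ /
        ((Finset.univ.filter fun b => g b = j).card : ℝ) ≤ dB * (Fintype.card A * Fintype.card B))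
    (hle : 10 * e + 8 * dA + 8 * dB ≤ η ^ 2) :
    G.IsHomogeneous η (fiberPartition Finset.univ f) (fiberPartition Finset.univ g) := by
  classical
  set X : ι → Finset A := fun i => Finset.univ.filter fun a => f a = i with hX
  set Y : κ → Finset B := fun j => Finset.univ.filter fun b => g b = j with hY
  set Hom : Fin 3 → Finset A × Finset B → Prop := fun u p =>
    (1 - η) * (p.1.card : ℝ) * (p.2.card : ℝ) ≤ ((G.edgeClass u ∩ p.1 ×ˢ p.2).card : ℝ) with hHom
  set PQ := (fiberPartition Finset.univ f).parts ×ˢ (fiberPartition Finset.univ g).parts with hPQ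
  refine ⟨PQ.filter (Hom 0), Finset.filter_subset _ _, PQ.filter (Hom 1), Finset.filter_subset _ _,
    ?_, fun p hp => (Finset.mem_filter.1 hp).2, fun p hp => (Finset.mem_filter.1 hp).2⟩
  set Cov := (PQ.filter (Hom 0) ∪ PQ.filter (Hom 1)).biUnion fun p => p.1 ×ˢ p.2 with hCov
  set I := (Finset.univ : Finset (ι × κ)).filter fun p =>
    ¬ Hom 0 (X p.1, Y p.2) ∧ ¬ Hom 1 (X p.1, Y p.2) with hI
  have hunc : Covᶜ ⊆ I.biUnion fun p => X p.1 ×ˢ Y p.2 := by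
    rintro ⟨a, b⟩ hab
    rw [Finset.mem_compl] at hab
    have hmem : (X (f a), Y (g b)) ∈ PQ := by
      rw [hPQ, Finset.mem_product]
      exact ⟨mem_fiberPartition.2 ⟨a, Finset.mem_univ _, rfl⟩,
        mem_fiberPartition.2 ⟨b, Finset.mem_univ _, rfl⟩⟩
    have hin : (a, b) ∈ X (f a) ×ˢ Y (g b) := by simp [hX, hY]
    rw [Finset.mem_biUnion]
    refine ⟨(f a, g b), ?_, hin⟩
    rw [hI, Finset.mem_filter]
    refine ⟨Finset.mem_univ _, fun h => hab ?_, fun h => hab ?_⟩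
    · exact Finset.mem_biUnion.2 ⟨_, Finset.mem_union_left _ (Finset.mem_filter.2 ⟨hmem, h⟩), hin⟩
    · exact Finset.mem_biUnion.2 ⟨_, Finset.mem_union_right _ (Finset.mem_filter.2 ⟨hmem, h⟩), hin⟩
  have hcell : ∀ p ∈ I, η * ((X p.1).card * (Y p.2).card : ℝ) ≤
      10 * ((G.edgeClass 2 ∩ X p.1 ×ˢ Y p.2).card : ℝ) +
      8 * (G.diffCount (X p.1) (Y p.2) / (X p.1).card) +
      8 * (G.swap.diffCount (Y p.2) (X p.1) / (Y p.2).card) := by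
    intro p hp
    obtain ⟨-, h0, h1⟩ := Finset.mem_filter.1 hp
    exact G.weight_le_of_not_homogeneous_cell hη (not_le.1 h0) (not_le.1 h1)
  -- Sum the cell estimate over the inhomogeneous cells, then extend to all cells: for a fixed cell
  -- on one side, the difference counts over the cells of the other side add up to the global one.
  have htot : η * ((Covᶜ).card : ℝ) ≤ η * (η * (Fintype.card A * Fintype.card B)) := by
    calc η * ((Covᶜ).card : ℝ) ≤ η * ∑ p ∈ I, ((X p.1).card * (Y p.2).card : ℝ) := by
          apply mul_le_mul_of_nonneg_left _ hη.le
          have := (Finset.card_le_card hunc).trans Finset.card_biUnion_le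
          simp only [Finset.card_product] at this
          exact_mod_cast this
      _ ≤ ∑ p ∈ I, (10 * ((G.edgeClass 2 ∩ X p.1 ×ˢ Y p.2).card : ℝ) +
          8 * (G.diffCount (X p.1) (Y p.2) / (X p.1).card) +
          8 * (G.swap.diffCount (Y p.2) (X p.1) / (Y p.2).card)) := by
          rw [Finset.mul_sum]; exact Finset.sum_le_sum hcell
      _ ≤ ∑ p : ι × κ, (10 * ((G.edgeClass 2 ∩ X p.1 ×ˢ Y p.2).card : ℝ) +
          8 * (G.diffCount (X p.1) (Y p.2) / (X p.1).card) +
          8 * (G.swap.diffCount (Y p.2) (X p.1) / (Y p.2).card)) := by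
          refine Finset.sum_le_sum_of_subset_of_nonneg (Finset.subset_univ _) fun p _ _ => ?_
          have := G.diffCount_nonneg (X p.1) (Y p.2)
          have := G.swap.diffCount_nonneg (Y p.2) (X p.1)
          positivity
      _ = 10 * ((G.edgeClass 2).card : ℝ) +
          8 * ∑ i, G.diffCount (X i) Finset.univ / (X i).card +
          8 * ∑ j, G.swap.diffCount (Y j) Finset.univ / (Y j).card := by
          rw [Finset.sum_add_distrib, Finset.sum_add_distrib, ← Finset.mul_sum, ← Finset.mul_sum,
            ← Finset.mul_sum, Fintype.sum_prod_type, Fintype.sum_prod_type,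
            Fintype.sum_prod_type_right]
          congr 2
          · congr 1
            exact G.sum_card_edgeClass_fiber 2 f g
          · congr 1
            refine Finset.sum_congr rfl fun i _ => ?_
            dsimp only
            rw [← Finset.sum_div, G.sum_diffCount_fiber]
          · refine Finset.sum_congr rfl fun j _ => ?_
            dsimp only
            rw [← Finset.sum_div, G.swap.sum_diffCount_fiber]
      _ ≤ (10 * e + 8 * dA + 8 * dB) * (Fintype.card A * Fintype.card B) := by linarith
      _ ≤ η ^ 2 * (Fintype.card A * Fintype.card B) := by gcongr
      _ = _ := by ring
  have hc := le_of_mul_le_mul_left htot hη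
  have hsum : (Cov.card : ℝ) + ((Covᶜ).card : ℝ) = Fintype.card A * Fintype.card B := by
    rw [← Nat.cast_mul, ← Fintype.card_prod]
    exact_mod_cast Finset.card_add_card_compl Cov
  nlinarith

end ColoredBipartite

/-- Cluster both sides at scale `q = √δ / 32`. The packing number is then exactly `c * (δ ^ k)⁻¹`
for `c = (4096 C) ^ k`, and the accumulated error, at most `74 q`, stays below `(2 δ ^ (1 / 16)) ^ 2
= 4 δ ^ (1 / 8) ≥ 128 q`. -/
theorem exists_isRemovalConstant (k : ℕ) : ∃ c : ℝ, IsRemovalConstant k c := by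
  obtain ⟨C, hC⟩ := exists_isPackingConstant k
  have hC1 := hC.1
  set c : ℝ := (4096 * C) ^ k with hc
  have hc1 : 1 ≤ c := one_le_pow₀ (by linarith)
  refine ⟨c, by linarith, ?_⟩
  intro ε δ hε _ hδ hδ2 hεδ A B _ _ _ _ G hE hcopy
  set d := Real.sqrt δ with hd
  have hd0 : 0 < d := Real.sqrt_pos.2 hδ
  have hdd : d ^ 2 = δ := Real.sq_sqrt hδ.le
  have hd1 : d ≤ 1 := by nlinarith
  set q := d / 32 with hq
  have hq0 : 0 < q := by positivity
  set M := ⌊(C / (q / 2) ^ 2) ^ k⌋₊ with hM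
  have hMval : (C / (q / 2) ^ 2) ^ k = c * (δ ^ k)⁻¹ := by
    rw [hc, ← inv_pow, ← mul_pow]
    congr 1
    rw [hq, ← hdd]
    field_simp
    norm_num
  have hMlt : (C / (q / 2) ^ 2) ^ k < (M : ℝ) + 1 := Nat.lt_floor_add_one _
  have hδk : 1 ≤ (δ ^ k)⁻¹ := (one_le_inv₀ (by positivity)).2 (pow_le_one₀ hδ.le (by linarith))
  have hMle : (M : ℝ) + 1 ≤ 2 * c * (δ ^ k)⁻¹ := by
    have h1 : (M : ℝ) ≤ c * (δ ^ k)⁻¹ := by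
      rw [← hMval]; exact Nat.floor_le (by rw [hMval]; positivity)
    have h2 : 1 ≤ c * (δ ^ k)⁻¹ := by nlinarith
    linarith
  have hMcard : (M : ℝ) + 1 ≤ 2 * c * ((δ / 8) ^ k)⁻¹ := by
    refine hMle.trans ?_
    have h : (δ / 8) ^ k ≤ δ ^ k := pow_le_pow_left₀ (by positivity) (by linarith) k
    gcongr
  -- The square of `ρ` is eight times the bound assumed on `ε`, so `ε ≤ ρ ^ 2`; and `ρ` is small
  -- enough for `(M + 1) * ρ ≤ q / 2`.
  set ρ := (c ^ 2)⁻¹ * (δ / 8) ^ (2 * k + 2) with hρ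
  have hρ0 : 0 < ρ := by positivity
  have hερ : ε ≤ ρ ^ 2 := by
    refine hεδ.trans ?_
    have h1 : ρ ^ 2 = (c ^ 4)⁻¹ * (δ / 8) ^ (4 * k + 4) := by
      rw [hρ, mul_pow, inv_pow, ← pow_mul, ← pow_mul]
      ring_nf
    rw [h1]
    have : 0 ≤ (c ^ 4)⁻¹ * (δ / 8) ^ (4 * k + 4) := by positivity
    linarith
  have hMρ : ((M : ℝ) + 1) * ρ ≤ q / 2 := by
    have h1 : (δ ^ k)⁻¹ * (δ / 8) ^ (2 * k + 2) ≤ (δ / 8) ^ 2 := by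
      have h2 : (δ / 8) ^ (2 * k + 2) ≤ δ ^ k * (δ / 8) ^ 2 := by
        rw [pow_add]
        gcongr
        calc (δ / 8) ^ (2 * k) ≤ (δ / 8) ^ k :=
              pow_le_pow_of_le_one (by positivity) (by linarith) (by omega)
          _ ≤ δ ^ k := pow_le_pow_left₀ (by positivity) (by linarith) k
      rw [inv_mul_le_iff₀ (by positivity)]
      exact h2
    have hcc : c * (c ^ 2)⁻¹ ≤ 1 := by
      rw [sq, mul_inv, ← mul_assoc, mul_inv_cancel₀ (by positivity), one_mul]
      exact inv_le_one_of_one_le₀ hc1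
    calc ((M : ℝ) + 1) * ρ ≤ 2 * c * (δ ^ k)⁻¹ * ρ := by gcongr
      _ = 2 * (c * (c ^ 2)⁻¹) * ((δ ^ k)⁻¹ * (δ / 8) ^ (2 * k + 2)) := by rw [hρ]; ring
      _ ≤ 2 * 1 * (δ / 8) ^ 2 := by gcongr
      _ ≤ q / 2 := by
        rw [hq, ← hdd]
        have : d ^ 2 ≤ 1 / 2 := by rw [hdd]; exact hδ2.le
        have h4 : d ^ 4 ≤ d ^ 2 / 2 := by nlinarith [sq_nonneg d]
        nlinarith
  have hρq : ρ ≤ q / 2 := by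
    have : 0 ≤ (M : ℝ) * ρ := by positivity
    linarith
  obtain ⟨f, hf⟩ := G.exists_clustering hC hcopy hq0 (by linarith) hρ0.le hMlt hMρ
  obtain ⟨g, hg⟩ := G.swap.exists_clustering hC (mt ColoredBipartite.hasCopy_swap.1 hcopy) hq0
    (by linarith) hρ0.le hMlt hMρ
  have hE2 : ((G.edgeClass 2).card : ℝ) ≤ ρ ^ 2 * Fintype.card A * Fintype.card B :=
    hE.trans (by gcongr)
  have hE2' : ((G.swap.edgeClass 2).card : ℝ) ≤ ρ ^ 2 * Fintype.card B * Fintype.card A := by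
    have : (G.swap.edgeClass 2).card = (G.edgeClass 2).card :=
      Finset.card_equiv (Equiv.prodComm B A)
        (fun p => by
          simp only [ColoredBipartite.edgeClass, Finset.mem_filter, Finset.mem_univ, true_and]
          rfl)
    rw [this]; linarith
  have hA := G.sum_diffCount_div_le f hρ0 hq0.le hE2 hf
  have hB := G.swap.sum_diffCount_div_le g hρ0 hq0.le hE2' hg
  rw [mul_comm (Fintype.card B : ℝ)] at hB
  rw [mul_assoc] at hE2
  refine ⟨fiberPartition Finset.univ f, fiberPartition Finset.univ g,
    G.isHomogeneous_fiberPartition f g (by positivity) hE2 hA hB ?_, ?_, ?_⟩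
  · have h1 : d ≤ δ ^ (1 / 8 : ℝ) := by
      rw [hd, Real.sqrt_eq_rpow]
      exact Real.rpow_le_rpow_of_exponent_ge hδ (by linarith) (by norm_num)
    have h2 : (2 * δ ^ (1 / 16 : ℝ)) ^ 2 = 4 * δ ^ (1 / 8 : ℝ) := by
      rw [mul_pow, ← Real.rpow_natCast (δ ^ (1 / 16 : ℝ)), ← Real.rpow_mul hδ.le]
      norm_num
    rw [h2]
    have h3 : ρ ^ 2 ≤ q := by nlinarith
    linarith
  · refine le_trans ?_ hMcard
    have := card_fiberPartition_le Finset.univ f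
    rw [Fintype.card_fin] at this
    exact_mod_cast this
  · refine le_trans ?_ hMcard
    have := card_fiberPartition_le Finset.univ g
    rw [Fintype.card_fin] at this
    exact_mod_cast this

/-! ### Almost good partitions from predictions -/

open Classical in
/-- If membership `y ∈ N_H(xz)` is predicted, up to few errors, by the class of `y` under `f`, then
the partition of `V` into the classes of `f` is almost good. -/
theorem isAlmostGoodPartition_of_prediction {α ι : Type*} [Fintype α] [DecidableEq α]
    [DecidableEq ι] (H : ThreeGraph α) (U V W : Finset α) (f : α → ι) (σ : α × α → ι → Prop)
    {η : ℝ} (hη : 0 < η)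
    (hE : ∑ p ∈ U ×ˢ W, ∑ y ∈ V, (if (y ∈ H.nbhd p.1 p.2 ↔ σ p (f y)) then (0 : ℝ) else 1) ≤
      η ^ 3 * (U.card * V.card * W.card)) :
    H.IsAlmostGoodPartition U W η (fiberPartition V f) := by
  set err : α × α → α → ℝ := fun p y => if (y ∈ H.nbhd p.1 p.2 ↔ σ p (f y)) then 0 else 1
    with herr
  have herr0 : ∀ p y, 0 ≤ err p y := fun p y => by simp only [herr]; split_ifs <;> norm_num
  set P := fiberPartition V f with hP
  set n : ℝ := (U.card : ℝ) * W.card with hn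
  have hn0 : 0 ≤ n := by positivity
  -- Markov over the parts: with error density `η ^ 3` overall, the parts of error density above `η
  -- ^ 2` cover at most an `η`-fraction of `V`. A second Markov, over the pairs in `U ×ˢ W`, is
  -- applied inside each remaining part.
  set Good : Finset α → Prop := fun X =>
    ∑ p ∈ U ×ˢ W, ∑ y ∈ X, err p y ≤ η ^ 2 * (X.card * n) with hGood
  refine ⟨P.parts.filter Good, Finset.filter_subset _ _, ?_, ?_⟩
  · have hdisj : (((P.parts.filter Good).biUnion id).card : ℝ) =
        ∑ X ∈ P.parts.filter Good, (X.card : ℝ) := by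
      rw [Finset.card_biUnion]
      · push_cast; rfl
      · intro X hX Y hY hne
        exact P.disjoint (Finset.mem_filter.1 hX).1 (Finset.mem_filter.1 hY).1 hne
    have hV : (V.card : ℝ) = ∑ X ∈ P.parts, (X.card : ℝ) := by
      exact_mod_cast P.sum_card_parts.symm
    have hsplit := Finset.sum_filter_add_sum_filter_not P.parts Good (fun X => (X.card : ℝ))
    have hbad : ∑ X ∈ P.parts.filter fun X => ¬ Good X, (X.card : ℝ) ≤ η * V.card := by
      rcases hn0.eq_or_lt with h0 | h0
      · have hall : ∀ X, Good X := by
          intro X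
          have : U ×ˢ W = ∅ := by
            rw [← Finset.card_eq_zero, Finset.card_product]
            rw [hn] at h0
            exact_mod_cast h0.symm
          simp [hGood, this, ← h0]
        simp only [hall, not_true_eq_false, Finset.filter_false, Finset.sum_empty]
        positivity
      · have h1 : η ^ 2 * n * ∑ X ∈ P.parts.filter fun X => ¬ Good X, (X.card : ℝ) ≤
            η ^ 2 * n * (η * V.card) := by
          calc _ = ∑ X ∈ P.parts.filter fun X => ¬ Good X, η ^ 2 * (X.card * n) := by
                rw [Finset.mul_sum]
                exact Finset.sum_congr rfl fun X _ => by ring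
            _ ≤ ∑ X ∈ P.parts.filter fun X => ¬ Good X, ∑ p ∈ U ×ˢ W, ∑ y ∈ X, err p y :=
                Finset.sum_le_sum fun X hX => (not_le.1 (Finset.mem_filter.1 hX).2).le
            _ ≤ ∑ X ∈ P.parts, ∑ p ∈ U ×ˢ W, ∑ y ∈ X, err p y :=
                Finset.sum_le_sum_of_subset_of_nonneg (Finset.filter_subset _ _) fun X _ _ =>
                  Finset.sum_nonneg fun p _ => Finset.sum_nonneg fun y _ => herr0 p y
            _ = ∑ p ∈ U ×ˢ W, ∑ y ∈ V, err p y := by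
                rw [Finset.sum_comm]
                refine Finset.sum_congr rfl fun p _ => ?_
                rw [← Finset.sum_biUnion]
                · congr 1
                  exact P.biUnion_parts
                · intro X hX Y hY hne
                  exact P.disjoint hX hY hne
            _ ≤ η ^ 3 * (U.card * V.card * W.card) := hE
            _ = _ := by rw [hn]; ring
        exact le_of_mul_le_mul_left h1 (by positivity)
    rw [hdisj]
    linarith
  · intro X hX
    obtain ⟨hXP, hXG⟩ := Finset.mem_filter.1 hX
    obtain ⟨a, haV, haX⟩ := mem_fiberPartition.1 hXP
    have hXpos : (0 : ℝ) < X.card := by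
      exact_mod_cast (P.nonempty_of_mem_parts hXP).card_pos
    have hfX : ∀ y ∈ X, f y = f a := by
      intro y hy; rw [← haX] at hy; exact (Finset.mem_filter.1 hy).2
    -- On a part the prediction is constant, so the errors are exactly the non-neighbors or exactly
    -- the neighbors in `X`.
    have hnear : ∀ p, ∑ y ∈ X, err p y < η * X.card →
        NearZeroOne η (((H.nbhd p.1 p.2 ∩ X).card : ℝ) / (X.card : ℝ)) := by
      intro p hp
      have hcount : ((H.nbhd p.1 p.2 ∩ X).card : ℝ) + ((X \ H.nbhd p.1 p.2).card : ℝ) = X.card := by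
        rw [Finset.inter_comm]
        exact_mod_cast Finset.card_inter_add_card_sdiff X (H.nbhd p.1 p.2)
      by_cases hs : σ p (f a)
      · right
        have h1 : ∑ y ∈ X, err p y = ((X \ H.nbhd p.1 p.2).card : ℝ) := by
          have : ∀ y ∈ X, err p y = if y ∉ H.nbhd p.1 p.2 then 1 else 0 := by
            intro y hy
            simp only [herr, hfX y hy, hs, iff_true]
            split_ifs <;> simp_all
          rw [Finset.sum_congr rfl this, Finset.sum_boole]
          congr 2
          ext y; simp
        rw [h1] at hp
        constructor
        · rw [lt_div_iff₀ hXpos]; linarith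
        · rw [div_le_one hXpos]
          have : (0 : ℝ) ≤ ((X \ H.nbhd p.1 p.2).card : ℝ) := by positivity
          linarith
      · left
        have h1 : ∑ y ∈ X, err p y = ((H.nbhd p.1 p.2 ∩ X).card : ℝ) := by
          have : ∀ y ∈ X, err p y = if y ∈ H.nbhd p.1 p.2 then 1 else 0 := by
            intro y hy
            simp only [herr, hfX y hy, hs, iff_false]
            split_ifs <;> simp_all
          rw [Finset.sum_congr rfl this, Finset.sum_boole]
          congr 2
          ext y; simp [and_comm]
        rw [h1] at hp
        exact ⟨by positivity, by rwa [div_lt_iff₀ hXpos]⟩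
    set Q := (U ×ˢ W).filter fun p =>
      ¬ NearZeroOne η (((H.nbhd p.1 p.2 ∩ X).card : ℝ) / (X.card : ℝ)) with hQ
    have hQle : (Q.card : ℝ) ≤ η * n := by
      have h1 : (η * X.card) * (Q.card : ℝ) ≤ (η * X.card) * (η * n) := by
        calc (η * X.card) * (Q.card : ℝ) = ∑ p ∈ Q, η * (X.card : ℝ) := by
              rw [Finset.sum_const, nsmul_eq_mul]; ring
          _ ≤ ∑ p ∈ Q, ∑ y ∈ X, err p y := by
              refine Finset.sum_le_sum fun p hp => ?_
              by_contra hlt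
              exact (Finset.mem_filter.1 hp).2 (hnear p (not_le.1 hlt))
          _ ≤ ∑ p ∈ U ×ˢ W, ∑ y ∈ X, err p y :=
              Finset.sum_le_sum_of_subset_of_nonneg (Finset.filter_subset _ _) fun p _ _ =>
                Finset.sum_nonneg fun y _ => herr0 p y
          _ ≤ η ^ 2 * (X.card * n) := hXG
          _ = _ := by ring
      exact le_of_mul_le_mul_left h1 (by positivity)
    have hsum := Finset.card_filter_add_card_filter_not (s := U ×ˢ W)
      (fun p => NearZeroOne η (((H.nbhd p.1 p.2 ∩ X).card : ℝ) / (X.card : ℝ)))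
    have hsum' : (((U ×ˢ W).filter fun p =>
        NearZeroOne η (((H.nbhd p.1 p.2 ∩ X).card : ℝ) / (X.card : ℝ))).card : ℝ) + Q.card = n := by
      rw [hn, ← Nat.cast_mul, ← Finset.card_product]
      exact_mod_cast hsum
    unfold ThreeGraph.IsAlmostGood
    have : (1 - η) * (U.card : ℝ) * W.card = n - η * n := by rw [hn]; ring
    rw [this]
    linarith

open Classical in
/-- Predictions from representatives: if for most `(x, z)` the sets `{y | R x y z}` are
approximated by those for some `z'` in a small set `T`, and every `z' ∈ T` hardly separates
elements of the same class of `f`, then the class of `y` predicts `R x y z` up to few errors. -/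
theorem exists_prediction {α ι : Type*} (R : α → α → α → Prop)
    (U V W T : Finset α) (f : α → ι) (Bad : Finset (α × α)) {b γ d : ℝ} {t : ℕ}
    (hd : 0 ≤ d) (hTt : T.card ≤ t)
    (hbad : (((U ×ˢ W).filter (· ∈ Bad)).card : ℝ) ≤ b * (U.card * W.card))
    (hrep : ∀ p ∈ U ×ˢ W, p ∉ Bad → ∃ z' ∈ T,
      ((V.filter fun y => ¬ (R p.1 y p.2 ↔ R p.1 y z')).card : ℝ) ≤ γ * V.card)
    (hγ : 0 ≤ γ)
    (hf : ∀ z ∈ T, ∀ y ∈ V, ∀ y' ∈ V, f y = f y' →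
      ((U.filter fun x => ¬ (R x y z ↔ R x y' z)).card : ℝ) ≤ d * U.card) :
    ∃ σ : α × α → ι → Prop,
      ∑ p ∈ U ×ˢ W, ∑ y ∈ V, (if (R p.1 y p.2 ↔ σ p (f y)) then (0 : ℝ) else 1) ≤
        (b + γ + t * d) * (U.card * V.card * W.card) := by
  have hex : ∀ p, ∃ z', p ∈ U ×ˢ W → p ∉ Bad → z' ∈ T ∧
      ((V.filter fun y => ¬ (R p.1 y p.2 ↔ R p.1 y z')).card : ℝ) ≤ γ * V.card := by
    intro p
    by_cases h : p ∈ U ×ˢ W ∧ p ∉ Bad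
    · obtain ⟨z, hz⟩ := hrep p h.1 h.2
      exact ⟨z, fun _ _ => hz⟩
    · exact ⟨p.1, fun h1 h2 => absurd ⟨h1, h2⟩ h⟩
  choose rep hrep' using hex
  -- The prediction evaluates `R` at the substitute `rep p` and at a chosen element of the class,
  -- which depends on the class alone.
  obtain ⟨σ, hσ⟩ : ∃ σ : α × α → ι → Prop,
      ∀ p i, σ p i ↔ ∃ h : ∃ y' ∈ V, f y' = i, R p.1 h.choose (rep p) := ⟨_, fun _ _ => Iff.rfl⟩
  refine ⟨σ, ?_⟩
  have hyr : ∀ y, ∃ y', y ∈ V → y' ∈ V ∧ f y' = f y ∧ ∀ p, σ p (f y) ↔ R p.1 y' (rep p) := by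
    intro y
    by_cases hy : y ∈ V
    · have h : ∃ y' ∈ V, f y' = f y := ⟨y, hy, rfl⟩
      refine ⟨h.choose, fun _ => ⟨h.choose_spec.1, h.choose_spec.2, fun p => ?_⟩⟩
      rw [hσ]
      exact ⟨fun ⟨_, h'⟩ => h', fun h' => ⟨h, h'⟩⟩
    · exact ⟨y, fun h => absurd h hy⟩
  choose yr hyr' using hyr
  -- An error comes from a bad pair, from replacing `z` by `rep p`, or from replacing `y` by `yr y`.
  -- The last is summed over all of `T`: since `rep p` varies with `x`, the bound `hf`, which counts
  -- `x` for fixed `z`, applies only after this union bound. It costs the factor `t`.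
  have key : ∀ p ∈ U ×ˢ W, ∀ y ∈ V, (if (R p.1 y p.2 ↔ σ p (f y)) then (0 : ℝ) else 1) ≤
      (if p ∈ Bad then 1 else 0) +
      (if p ∉ Bad ∧ ¬ (R p.1 y p.2 ↔ R p.1 y (rep p)) then 1 else 0) +
      ∑ z ∈ T, (if ¬ (R p.1 y z ↔ R p.1 (yr y) z) then 1 else 0) := by
    intro p hp y hy
    have hs0 : 0 ≤ ∑ z ∈ T, (if ¬ (R p.1 y z ↔ R p.1 (yr y) z) then (1 : ℝ) else 0) :=
      Finset.sum_nonneg fun z _ => by split_ifs <;> norm_num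
    by_cases hB : p ∈ Bad
    · rw [if_pos hB]
      have h1 : (if (R p.1 y p.2 ↔ σ p (f y)) then (0 : ℝ) else 1) ≤ 1 := by
        split_ifs <;> norm_num
      have h2 : (0 : ℝ) ≤ if p ∉ Bad ∧ ¬ (R p.1 y p.2 ↔ R p.1 y (rep p)) then 1 else 0 := by
        split_ifs <;> norm_num
      linarith
    rw [if_neg hB, zero_add]
    by_cases h1 : R p.1 y p.2 ↔ R p.1 y (rep p)
    · by_cases h2 : R p.1 y (rep p) ↔ R p.1 (yr y) (rep p)
      · rw [if_pos (by rw [(hyr' y hy).2.2 p]; exact h1.trans h2)]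
        have h3 : (0 : ℝ) ≤ if p ∉ Bad ∧ ¬ (R p.1 y p.2 ↔ R p.1 y (rep p)) then 1 else 0 := by
          split_ifs <;> norm_num
        linarith
      · have h3 := Finset.single_le_sum (s := T)
          (f := fun z => if ¬ (R p.1 y z ↔ R p.1 (yr y) z) then (1 : ℝ) else 0)
          (fun z _ => by split_ifs <;> norm_num) (hrep' p hp hB).1
        simp only [if_pos h2] at h3
        have h4 : (if (R p.1 y p.2 ↔ σ p (f y)) then (0 : ℝ) else 1) ≤ 1 := by
          split_ifs <;> norm_num
        have h5 : (0 : ℝ) ≤ if p ∉ Bad ∧ ¬ (R p.1 y p.2 ↔ R p.1 y (rep p)) then 1 else 0 := by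
          split_ifs <;> norm_num
        linarith
    · rw [if_pos (⟨hB, h1⟩ : p ∉ Bad ∧ ¬ (R p.1 y p.2 ↔ R p.1 y (rep p)))]
      have h4 : (if (R p.1 y p.2 ↔ σ p (f y)) then (0 : ℝ) else 1) ≤ 1 := by
        split_ifs <;> norm_num
      linarith
  have hs1 : ∑ p ∈ U ×ˢ W, ∑ y ∈ V, (if p ∈ Bad then (1 : ℝ) else 0) ≤
      b * (U.card * V.card * W.card) := by
    rw [Finset.sum_comm]
    simp only [Finset.sum_boole, Finset.sum_const, nsmul_eq_mul]
    calc (V.card : ℝ) * _ ≤ V.card * (b * (U.card * W.card)) :=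
          mul_le_mul_of_nonneg_left hbad (by positivity)
      _ = _ := by ring
  have hs2 : ∑ p ∈ U ×ˢ W, ∑ y ∈ V,
      (if p ∉ Bad ∧ ¬ (R p.1 y p.2 ↔ R p.1 y (rep p)) then (1 : ℝ) else 0) ≤
      γ * (U.card * V.card * W.card) := by
    calc _ ≤ ∑ p ∈ U ×ˢ W, γ * (V.card : ℝ) := by
          refine Finset.sum_le_sum fun p hp => ?_
          by_cases hB : p ∈ Bad
          · simp only [hB, not_true_eq_false, false_and, if_false, Finset.sum_const_zero]
            positivity
          · simp only [hB, not_false_eq_true, true_and]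
            rw [Finset.sum_boole]
            exact (hrep' p hp hB).2
      _ = _ := by
          rw [Finset.sum_const, Finset.card_product, nsmul_eq_mul]; push_cast; ring
  have hs3 : ∑ p ∈ U ×ˢ W, ∑ y ∈ V,
      ∑ z ∈ T, (if ¬ (R p.1 y z ↔ R p.1 (yr y) z) then (1 : ℝ) else 0) ≤
      t * d * (U.card * V.card * W.card) := by
    calc _ = ∑ w ∈ W, ∑ y ∈ V, ∑ z ∈ T, ∑ x ∈ U,
          (if ¬ (R x y z ↔ R x (yr y) z) then (1 : ℝ) else 0) := by
          rw [Finset.sum_product_right]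
          refine Finset.sum_congr rfl fun w _ => ?_
          rw [Finset.sum_comm]
          refine Finset.sum_congr rfl fun y _ => ?_
          rw [Finset.sum_comm]
      _ ≤ ∑ w ∈ W, ∑ y ∈ V, ∑ z ∈ T, d * (U.card : ℝ) := by
          refine Finset.sum_le_sum fun w _ => Finset.sum_le_sum fun y hy =>
            Finset.sum_le_sum fun z hz => ?_
          rw [Finset.sum_boole]
          exact hf z hz y hy (yr y) (hyr' y hy).1 (hyr' y hy).2.1.symm
      _ = T.card * (d * (U.card * V.card * W.card)) := by
          simp only [Finset.sum_const, nsmul_eq_mul]; ring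
      _ ≤ t * (d * (U.card * V.card * W.card)) := by gcongr
      _ = _ := by ring
  refine (Finset.sum_le_sum fun p hp => Finset.sum_le_sum (key p hp)).trans ?_
  simp only [Finset.sum_add_distrib]
  rw [add_mul, add_mul]
  exact add_le_add (add_le_add hs1 hs2) hs3

/-! ### Slices: similar vertices of `W` and clusters of `V` -/

/-- In a slice with a reduced graph, for most `z ∈ W` the neighborhood of `z` in `V` is close to
that of a positive proportion of the `z' ∈ W`. -/
theorem IsReducedSlice.exists_exceptional {α : Type*} [Fintype α] [DecidableEq α]
    {H : ThreeGraph α} {V W : Finset α} {ℓ : ℕ} {s : ℝ} (hs0 : 0 < s)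
    (hs : s ≤ 1 / 2) {m n : ℕ} {𝒢 : ColoredBipartite (Fin (m + 1)) (Fin (n + 1))} {x : α}
    (h : IsReducedSlice H V W ℓ (s ^ 2) 𝒢 x) (h2 : ∀ i j, j ≠ 0 → 𝒢.color i j ≠ 2) :
    open Classical in
    ∃ Z : Finset α, (Z.card : ℝ) ≤ 2 * s * W.card ∧ ∀ z ∈ W, z ∉ Z →
      1 / (2 * (ℓ : ℝ)) * W.card ≤ ((W.filter fun z' => ((V.filter fun y =>
        ¬ (({x, y, z} : Finset α) ∈ H.edges ↔ ({x, y, z'} : Finset α) ∈ H.edges)).card : ℝ) ≤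
          2 * s * V.card).card : ℝ) := by
  classical
  obtain ⟨B, C, ⟨hBd, hBV⟩, ⟨hCd, hCW⟩, hc0, hc1, hBs, hCs, hB0, hC0⟩ := h
  set R : α → α → Prop := fun y z => ({x, y, z} : Finset α) ∈ H.edges with hR
  -- The model neighborhood shared by the vertices of `C j`. As column `j ≠ 0` has no color `2`, it
  -- is accurate up to density `s ^ 2` on every `B i`, including `B 0`.
  set Mj : Fin (n + 1) → α → Prop := fun j y => ∃ i, y ∈ B i ∧ 𝒢.color i j = 1 with hMj
  set w : Fin (n + 1) → α → ℝ := fun j z => ((V.filter fun y => ¬ (R y z ↔ Mj j y)).card : ℝ)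
    with hw
  have hCsub : ∀ j, C j ⊆ W := fun j => hCW ▸ Finset.subset_biUnion_of_mem C (Finset.mem_univ j)
  have hM : ∀ i j, ∀ y ∈ B i, (Mj j y ↔ 𝒢.color i j = 1) := by
    intro i j y hy
    refine ⟨fun ⟨i', hy', hc⟩ => ?_, fun hc => ⟨i, hy, hc⟩⟩
    by_cases hii : i' = i
    · rwa [← hii]
    · exact absurd hy (Finset.disjoint_left.1 (hBd i' i hii) hy')
  have hcell : ∀ i j, j ≠ 0 →
      (((B i ×ˢ C j).filter fun p => ¬ (R p.1 p.2 ↔ Mj j p.1)).card : ℝ) ≤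
        s ^ 2 * ((B i).card * (C j).card) := by
    intro i j hj
    have hsplit : (((B i ×ˢ C j).filter fun p => (R p.1 p.2 ↔ Mj j p.1)).card : ℝ) +
        (((B i ×ˢ C j).filter fun p => ¬ (R p.1 p.2 ↔ Mj j p.1)).card : ℝ) =
        (B i).card * (C j).card := by
      rw [← Nat.cast_mul, ← Finset.card_product]
      exact_mod_cast Finset.card_filter_add_card_filter_not (s := B i ×ˢ C j) _
    have hlow : (1 - s ^ 2) * ((B i).card : ℝ) * ((C j).card : ℝ) ≤
        (((B i ×ˢ C j).filter fun p => (R p.1 p.2 ↔ Mj j p.1)).card : ℝ) := by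
      have hcol : 𝒢.color i j = 0 ∨ 𝒢.color i j = 1 := by
        have := h2 i j hj
        revert this
        generalize 𝒢.color i j = u
        revert u
        decide
      rcases hcol with hcol | hcol
      · refine (hc0 i j hcol).trans ?_
        simp only [signedEdgeCount, Bool.false_eq_true, if_false]
        norm_cast
        apply Finset.card_le_card
        rintro ⟨y, z⟩ hp
        rw [SimpleGraph.mem_interedges_iff, SimpleGraph.compl_adj] at hp
        rw [Finset.mem_filter, Finset.mem_product]
        refine ⟨⟨hp.1, hp.2.1⟩, ?_⟩
        rw [hM i j y hp.1, hcol]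
        have : ¬ R y z := fun hyz => hp.2.2.2 ⟨hp.2.2.1, hyz⟩
        simp [this]
      · refine (hc1 i j hcol).trans ?_
        simp only [signedEdgeCount, if_true]
        norm_cast
        apply Finset.card_le_card
        rintro ⟨y, z⟩ hp
        rw [SimpleGraph.mem_interedges_iff] at hp
        rw [Finset.mem_filter, Finset.mem_product]
        refine ⟨⟨hp.1, hp.2.1⟩, ?_⟩
        rw [hM i j y hp.1, hcol]
        have : R y z := hp.2.2.2
        simp [this]
    linarith
  have hVcard : ∑ i, ((B i).card : ℝ) = V.card := by
    rw [← hBV, Finset.card_biUnion fun i _ j _ hij => hBd i j hij]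
    push_cast; rfl
  have hsumw : ∀ j, j ≠ 0 → ∑ z ∈ C j, w j z ≤ s ^ 2 * (V.card * (C j).card) := by
    intro j hj
    have h1 : ∑ z ∈ C j, w j z =
        ∑ i, (((B i ×ˢ C j).filter fun p => ¬ (R p.1 p.2 ↔ Mj j p.1)).card : ℝ) := by
      calc ∑ z ∈ C j, w j z = ∑ z ∈ C j, ∑ i, ∑ y ∈ B i,
            (if ¬ (R y z ↔ Mj j y) then (1 : ℝ) else 0) := by
            refine Finset.sum_congr rfl fun z _ => ?_
            rw [← Finset.sum_biUnion fun i _ j _ hij => hBd i j hij, hBV, Finset.sum_boole]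
        _ = _ := by
            rw [Finset.sum_comm]
            refine Finset.sum_congr rfl fun i _ => ?_
            rw [← Finset.sum_boole, Finset.sum_product_right]
    rw [h1]
    calc _ ≤ ∑ i, s ^ 2 * (((B i).card : ℝ) * (C j).card) :=
          Finset.sum_le_sum fun i _ => hcell i j hj
      _ = _ := by rw [← Finset.mul_sum, ← Finset.sum_mul, hVcard]
  -- Markov splits the error `s ^ 2`: at most an `s`-fraction of `C j` deviates from the model by
  -- more than `s * V.card`.
  set D : Fin (n + 1) → Finset α := fun j => (C j).filter fun z => s * V.card < w j z with hD
  have hDc : ∀ j, j ≠ 0 → ((D j).card : ℝ) ≤ s * (C j).card := by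
    intro j hj
    rcases Nat.eq_zero_or_pos V.card with h0 | h0
    · have : D j = ∅ := by
        apply Finset.filter_eq_empty_iff.2
        intro z _
        have : V = ∅ := Finset.card_eq_zero.1 h0
        simp [hw, this]
      rw [this]; simp; positivity
    · have hV0 : (0 : ℝ) < V.card := by exact_mod_cast h0
      have h1 : s * V.card * ((D j).card : ℝ) ≤ s * V.card * (s * (C j).card) := by
        calc _ = ∑ z ∈ D j, s * (V.card : ℝ) := by rw [Finset.sum_const, nsmul_eq_mul]; ring
          _ ≤ ∑ z ∈ D j, w j z := Finset.sum_le_sum fun z hz => (Finset.mem_filter.1 hz).2.le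
          _ ≤ ∑ z ∈ C j, w j z := Finset.sum_le_sum_of_subset_of_nonneg
              (Finset.filter_subset _ _) fun z _ _ => by simp only [hw]; positivity
          _ ≤ _ := hsumw j hj
          _ = _ := by ring
      exact le_of_mul_le_mul_left h1 (by positivity)
  have hWcard : ∑ j, ((C j).card : ℝ) = W.card := by
    rw [← hCW, Finset.card_biUnion fun i _ j _ hij => hCd i j hij]
    push_cast; rfl
  refine ⟨C 0 ∪ (Finset.univ.erase (0 : Fin (n + 1))).biUnion D, ?_, ?_⟩
  · have h1 : (((Finset.univ.erase (0 : Fin (n + 1))).biUnion D).card : ℝ) ≤ s * W.card := by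
      calc _ ≤ ∑ j ∈ Finset.univ.erase (0 : Fin (n + 1)), ((D j).card : ℝ) := by
            exact_mod_cast Finset.card_biUnion_le
        _ ≤ ∑ j ∈ Finset.univ.erase (0 : Fin (n + 1)), s * ((C j).card : ℝ) :=
            Finset.sum_le_sum fun j hj => hDc j (Finset.ne_of_mem_erase hj)
        _ ≤ ∑ j, s * ((C j).card : ℝ) := Finset.sum_le_sum_of_subset_of_nonneg
            (Finset.erase_subset _ _) fun j _ _ => by positivity
        _ = _ := by rw [← Finset.mul_sum, hWcard]
    have h3 : ((C 0 ∪ (Finset.univ.erase (0 : Fin (n + 1))).biUnion D).card : ℝ) ≤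
        (C 0).card + ((Finset.univ.erase (0 : Fin (n + 1))).biUnion D).card := by
      exact_mod_cast Finset.card_union_le _ _
    have h4 : s ^ 2 * (W.card : ℝ) ≤ s * W.card := by
      apply mul_le_mul_of_nonneg_right _ (by positivity); nlinarith
    linarith
  · intro z hzW hzZ
    rw [← hCW, Finset.mem_biUnion] at hzW
    obtain ⟨j, -, hzj⟩ := hzW
    have hj : j ≠ 0 := by
      rintro rfl
      exact hzZ (Finset.mem_union_left _ hzj)
    have hwz : ∀ z' ∈ C j, z' ∉ D j → w j z' ≤ s * V.card := by
      intro z' hz' hzD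
      by_contra hlt
      exact hzD (Finset.mem_filter.2 ⟨hz', not_le.1 hlt⟩)
    have hzD : z ∉ D j := fun hz => hzZ (Finset.mem_union_right _
      (Finset.mem_biUnion.2 ⟨j, Finset.mem_erase.2 ⟨hj, Finset.mem_univ _⟩, hz⟩))
    -- Two vertices of `C j` outside `D j` are both close to the same model, hence to each other.
    -- Such vertices make up at least half of `C j`, which has `W.card / ℓ` elements.
    have hsub : C j \ D j ⊆ W.filter fun z' => ((V.filter fun y =>
        ¬ (R y z ↔ R y z')).card : ℝ) ≤ 2 * s * V.card := by
      intro z' hz'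
      rw [Finset.mem_sdiff] at hz'
      rw [Finset.mem_filter]
      refine ⟨hCsub j hz'.1, ?_⟩
      have h5 : (V.filter fun y => ¬ (R y z ↔ R y z')) ⊆
          (V.filter fun y => ¬ (R y z ↔ Mj j y)) ∪ V.filter fun y => ¬ (R y z' ↔ Mj j y) := by
        intro y
        simp only [Finset.mem_filter, Finset.mem_union]
        generalize Mj j y = p, R y z = p', R y z' = p''
        tauto
      have h6 : ((V.filter fun y => ¬ (R y z ↔ R y z')).card : ℝ) ≤ w j z + w j z' := by
        simp only [hw]
        exact_mod_cast (Finset.card_le_card h5).trans (Finset.card_union_le _ _)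
      linarith [hwz z hzj hzD, hwz z' hz'.1 hz'.2]
    have h7 : ((C j \ D j).card : ℝ) = (C j).card - (D j).card := by
      rw [Finset.card_sdiff_of_subset (Finset.filter_subset _ _), Nat.cast_sub
        (Finset.card_le_card (Finset.filter_subset _ _))]
    refine le_trans ?_ (Nat.cast_le.2 (Finset.card_le_card hsub))
    rw [h7]
    have h9 : 1 / (2 * (ℓ : ℝ)) * W.card = (C j).card / 2 := by
      rw [hCs j hj]; field_simp
    rw [h9]
    have h10 : s * ((C j).card : ℝ) ≤ 1 / 2 * (C j).card := by gcongr
    linarith [hDc j hj]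

theorem ThreeGraph.not_hasPowerSetConfig_slice {α : Type*} [DecidableEq α] {H : ThreeGraph α}
    {k : ℕ} (h : H.svc < (k : ℕ∞)) (x : α) : ¬ HasPowerSetConfig (H.slice x) k := by
  intro hc
  refine absurd h (not_lt.2 ?_)
  refine le_trans ?_ (le_iSup (fun x => vcDim (H.slice x)) x)
  exact le_iSup₂ (f := fun (k : ℕ) (_ : HasPowerSetConfig (H.slice x) k) => (k : ℕ∞)) k hc

open Classical in
/-- Clusters of `V` with respect to the slice graph of `z` between `U` and `V`. -/
theorem ThreeGraph.exists_slice_clustering {α : Type*} [DecidableEq α] {H : ThreeGraph α}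
    {U V : Finset α} (hUV : Disjoint U V) {k : ℕ} (hk : H.svc < (k : ℕ∞)) {C : ℝ}
    (hC : IsPackingConstant k C) {q : ℝ} (hq : 0 < q) (hq1 : q ≤ 1)
    {M : ℕ} (hM : (C / (q / 2) ^ 2) ^ k < (M : ℝ) + 1) (z : α) :
    ∃ f : α → Fin (M + 1), ∀ y ∈ V, ∀ y' ∈ V, f y = f y' →
      ((U.filter fun x => ¬ (({x, y, z} : Finset α) ∈ H.edges ↔
        ({x, y', z} : Finset α) ∈ H.edges)).card : ℝ) ≤ 3 * q * U.card := by
  -- Edges of the slice receive color `0`, matching the role of `E₀` in a copy of `U(k)`. Color `2`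
  -- does not occur, so the clustering applies with `ρ = 0`.
  let G : ColoredBipartite V U :=
    ⟨fun y x => if ({x.1, y.1, z} : Finset α) ∈ H.edges then 0 else 1⟩
  have hcol0 : ∀ y x, G.color y x = 0 ↔ ({x.1, y.1, z} : Finset α) ∈ H.edges := by
    intro y x; simp only [G]; split_ifs with h <;> simp [h]
  have hcol1 : ∀ y x, G.color y x = 1 ↔ ({x.1, y.1, z} : Finset α) ∉ H.edges := by
    intro y x; simp only [G]; split_ifs with h <;> simp [h]
  have hcol2 : ∀ y x, G.color y x ≠ 2 := by
    intro y x; simp only [G]; split_ifs <;> decide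
  have hne : ∀ (y : V) (x : U), y.1 ≠ x.1 := fun y x h =>
    Finset.disjoint_left.1 hUV x.2 (h ▸ y.2)
  have hset : ∀ x y : α, ({x, y, z} : Finset α) = {z, y, x} := by
    intro x y; ext a; simp only [Finset.mem_insert, Finset.mem_singleton]; tauto
  have hset' : ∀ x y : α, ({x, y, z} : Finset α) = {z, x, y} := by
    intro x y; ext a; simp only [Finset.mem_insert, Finset.mem_singleton]; tauto
  have hcopy : ¬ G.HasCopy 0 1 k := by
    rintro (⟨a, b, hab⟩ | ⟨a, b, hab⟩)
    · refine not_hasPowerSetConfig_slice hk z ⟨fun i => a i, fun S => b S, fun i S => ?_⟩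
      constructor
      · intro hadj
        by_contra hi
        refine (hcol1 _ _).1 ((hab i S).2 hi) ?_
        rw [hset]; exact hadj.2
      · intro hi
        refine ⟨hne _ _, ?_⟩
        rw [← hset]; exact (hcol0 _ _).1 ((hab i S).1 hi)
    · refine not_hasPowerSetConfig_slice hk z ⟨fun i => a i, fun S => b S, fun i S => ?_⟩
      constructor
      · intro hadj
        by_contra hi
        refine (hcol1 _ _).1 ((hab i S).2 hi) ?_
        rw [hset']; exact hadj.2
      · intro hi
        refine ⟨(hne _ _).symm, ?_⟩
        rw [← hset']; exact (hcol0 _ _).1 ((hab i S).1 hi)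
  obtain ⟨f, hf⟩ := G.exists_clustering hC hcopy hq hq1 le_rfl hM (by simp; positivity)
  have hN : ∀ y, G.nbhdLeft 2 y = ∅ := by
    intro y
    apply Finset.filter_eq_empty_iff.2
    exact fun x _ => hcol2 y x
  refine ⟨fun y => if h : y ∈ V then f ⟨y, h⟩ else 0, fun y hy y' hy' hff => ?_⟩
  simp only [hy, hy', dif_pos] at hff
  have h1 := hf ⟨y, hy⟩ ⟨y', hy'⟩ hff (by simp [hN]) (by simp [hN])
  rw [Fintype.card_coe] at h1
  refine le_trans ?_ h1
  norm_cast
  rw [← Finset.card_map (Function.Embedding.subtype (· ∈ U))]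
  apply Finset.card_le_card
  intro x hx
  rw [Finset.mem_filter] at hx
  refine Finset.mem_map.2 ⟨⟨x, hx.1⟩, ?_, rfl⟩
  rw [ColoredBipartite.mem_diffSet, hcol0, hcol0, hcol1, hcol1]
  have := hx.2
  simp only
  tauto

/-- The common refinement of the clusterings of `V` by a few slices is almost good. -/
theorem exists_isAlmostGoodPartition {α : Type*} [Fintype α] [DecidableEq α] {H : ThreeGraph α}
    {U V W : Finset α} (hUV : Disjoint U V) {k : ℕ} (hk : H.svc < (k : ℕ∞)) {C : ℝ}
    (hC : IsPackingConstant k C) {q : ℝ} (hq : 0 < q) (hq1 : q ≤ 1)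
    {M : ℕ} (hM : (C / (q / 2) ^ 2) ^ k < (M : ℝ) + 1)
    {ℓ : ℕ} (hℓ : 1 ≤ ℓ) {s : ℝ} (hs0 : 0 < s) (hs : s ≤ 1 / 2)
    {m n : ℕ} {𝒢 : ColoredBipartite (Fin (m + 1)) (Fin (n + 1))}
    (hred : ∀ x ∈ U, IsReducedSlice H V W ℓ (s ^ 2) 𝒢 x) (h2 : ∀ i j, j ≠ 0 → 𝒢.color i j ≠ 2)
    (t : ℕ) {η : ℝ} (hη : 0 < η)
    (hle : 4 * s + (1 - 1 / (2 * (ℓ : ℝ))) ^ t + t * (3 * q) ≤ η ^ 3) :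
    ∃ P : Finpartition V, H.IsAlmostGoodPartition U W η P ∧ P.parts.card ≤ (M + 1) ^ t := by
  classical
  have hℓ' : (1 : ℝ) ≤ ℓ := by exact_mod_cast hℓ
  have hp1 : 1 / (2 * (ℓ : ℝ)) ≤ 1 := by
    rw [div_le_one (by positivity)]; linarith
  choose! Z hZc hZ using fun x hx => (hred x hx).exists_exceptional hs0 hs h2
  set R : α → α → α → Prop := fun x y z => ({x, y, z} : Finset α) ∈ H.edges with hR
  -- The possible substitutes for `z` as seen from `x`, where `p = (x, z)`. For non-exceptional `z`
  -- they have density at least `1 / (2 ℓ)` in `W`, so the greedy hitting set applies.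
  set Cl : α × α → Finset α := fun p => W.filter fun z' => ((V.filter fun y =>
      ¬ (R p.1 y p.2 ↔ R p.1 y z')).card : ℝ) ≤ 2 * s * V.card with hCl
  set I := (U ×ˢ W).filter fun p => p.2 ∉ Z p.1 with hI
  have hT : ∃ T ⊆ W, T.card ≤ t ∧ ((I.filter fun p => ∀ w ∈ T, w ∉ Cl p).card : ℝ) ≤
      (1 - 1 / (2 * (ℓ : ℝ))) ^ t * (I.card : ℝ) := by
    rcases W.eq_empty_or_nonempty with hW | hW
    · refine ⟨∅, by simp, by simp, ?_⟩
      have : I = ∅ := by simp [hI, hW]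
      simp [this]
    · obtain ⟨T, hTW, hTt, hT⟩ := exists_hitting_set I W hW Cl hp1 (fun p hp => by
        obtain ⟨hpUW, hpZ⟩ := Finset.mem_filter.1 hp
        rw [Finset.mem_product] at hpUW
        rw [Finset.inter_eq_right.2 (Finset.filter_subset _ _)]
        exact hZ p.1 hpUW.1 p.2 hpUW.2 hpZ) t
      refine ⟨T, hTW, hTt, ?_⟩
      convert hT
  obtain ⟨T, hTW, hTt, hThit⟩ := hT
  choose f hf using fun z : α =>
    ThreeGraph.exists_slice_clustering hUV hk hC hq hq1 hM z
  -- The fibers of `F` form the common refinement of the clusterings attached to the vertices of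
  -- `T`.
  set F : α → (T → Fin (M + 1)) := fun y z => f z y with hF
  set Bad : Finset (α × α) := (U ×ˢ W).filter (fun p => p.2 ∈ Z p.1) ∪
    I.filter fun p => ∀ w ∈ T, w ∉ Cl p with hBad
  have hBadc : (((U ×ˢ W).filter (· ∈ Bad)).card : ℝ) ≤
      (2 * s + (1 - 1 / (2 * (ℓ : ℝ))) ^ t) * (U.card * W.card) := by
    have h1 : (((U ×ˢ W).filter (fun p => p.2 ∈ Z p.1)).card : ℝ) ≤
        2 * s * (U.card * W.card) := by
      rw [← Finset.sum_boole, Finset.sum_product]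
      calc _ ≤ ∑ x ∈ U, 2 * s * (W.card : ℝ) := by
            refine Finset.sum_le_sum fun x hx => ?_
            rw [Finset.sum_boole]
            refine le_trans ?_ (hZc x hx)
            norm_cast
            exact Finset.card_le_card fun z hz => (Finset.mem_filter.1 hz).2
        _ = _ := by rw [Finset.sum_const, nsmul_eq_mul]; ring
    have h3 : ((I.filter fun p => ∀ w ∈ T, w ∉ Cl p).card : ℝ) ≤
        (1 - 1 / (2 * (ℓ : ℝ))) ^ t * (U.card * W.card) := by
      refine hThit.trans (mul_le_mul_of_nonneg_left ?_ (pow_nonneg (by linarith) _))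
      rw [← Nat.cast_mul, ← Finset.card_product]
      exact_mod_cast Finset.card_le_card (Finset.filter_subset _ _)
    have h4 : (((U ×ˢ W).filter (· ∈ Bad)).card : ℝ) ≤
        ((U ×ˢ W).filter (fun p => p.2 ∈ Z p.1)).card +
          (I.filter fun p => ∀ w ∈ T, w ∉ Cl p).card := by
      have : (U ×ˢ W).filter (· ∈ Bad) ⊆ Bad := fun p hp => (Finset.mem_filter.1 hp).2
      exact_mod_cast (Finset.card_le_card this).trans (Finset.card_union_le _ _)
    linarith
  obtain ⟨σ, hσ⟩ := exists_prediction R U V W T F Bad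
    (b := 2 * s + (1 - 1 / (2 * (ℓ : ℝ))) ^ t) (γ := 2 * s) (d := 3 * q) (t := t)
    (by positivity) hTt (by convert hBadc) (by
      intro p hp hpB
      have hpI : p ∈ I := by
        rw [hI, Finset.mem_filter]
        exact ⟨hp, fun hz => hpB (Finset.mem_union_left _ (Finset.mem_filter.2 ⟨hp, hz⟩))⟩
      have hex : ¬ ∀ w ∈ T, w ∉ Cl p := fun hz =>
        hpB (Finset.mem_union_right _ (Finset.mem_filter.2 ⟨hpI, hz⟩))
      push Not at hex
      obtain ⟨w, hw, hwC⟩ := hex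
      exact ⟨w, hw, (Finset.mem_filter.1 hwC).2⟩) (by positivity) (by
      intro z hz y hy y' hy' hyy
      exact hf z y hy y' hy' (congrFun hyy ⟨z, hz⟩))
  have hmem : ∀ (p : α × α) (y : α), y ∈ H.nbhd p.1 p.2 ↔ R p.1 y p.2 := by
    intro p y
    simp only [ThreeGraph.nbhd, Finset.mem_filter, Finset.mem_univ, true_and, hR]
    rw [Finset.pair_comm]
  refine ⟨fiberPartition V F, isAlmostGoodPartition_of_prediction H U V W F σ hη ?_, ?_⟩
  · simp only [hmem]
    refine le_trans (le_of_eq ?_) (hσ.trans ?_)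
    · refine Finset.sum_congr rfl fun p _ => Finset.sum_congr rfl fun y _ => ?_
      congr
    · gcongr
      linarith
  · refine (card_fiberPartition_le V F).trans ?_
    rw [Fintype.card_fun, Fintype.card_fin, Fintype.card_coe]
    exact Nat.pow_le_pow_right (by omega) hTt

/-! ### Choice of parameters -/

theorem muParam_sq (k : ℕ) (c : ℝ) {s : ℝ} (hs : 0 < s) :
    muParam k c (s ^ 2) = 8 * (16 * c ^ 4) ^ (1 / (4 * (k : ℝ) + 4)) *
      s ^ (1 / 8 * (1 / (4 * (k : ℝ) + 4))) := by
  have h1 : (s ^ 2) ^ (1 / 16 : ℝ) = s ^ (1 / 8 : ℝ) := by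
    rw [← Real.rpow_natCast, ← Real.rpow_mul hs.le]; norm_num
  have h2 : 16 * (s ^ 2) ^ (1 / 16 : ℝ) * c ^ 4 = 16 * c ^ 4 * s ^ (1 / 8 : ℝ) := by
    rw [h1]; ring
  unfold muParam
  rw [h2, Real.mul_rpow (by positivity) (by positivity), Real.rpow_mul hs.le, mul_assoc]

open Filter Topology in
/-- Smallness conditions for the choice of `ε = s ^ 2`. -/
theorem eventually_small {k : ℕ} (hk : 1 ≤ k) {c : ℝ} (hc : 0 < c) (C : ℝ) (ℓ : ℕ) :
    ∀ᶠ s : ℝ in 𝓝[>] 0, s ≤ 1 / 2 ∧ s ^ 2 * ((ℓ : ℝ) + 1) < 1 ∧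
      (10 + 2 * (ℓ : ℝ)) * s ≤ (6 * muParam k c (s ^ 2) ^ (1 / 512 : ℝ)) ^ 3 ∧
      2 ≤ 2 * c * ((muParam k c (s ^ 2) / 8) ^ k)⁻¹ ∧
      (2 * ((4 * C) ^ k * (1 / s) ^ (4 * k))) ^ 2 ≤ (2 : ℝ) ^ (1 / s) := by
  have hpos : ∀ᶠ s : ℝ in 𝓝[>] 0, 0 < s := eventually_mem_nhdsWithin
  have hid : Tendsto (fun s : ℝ => s) (𝓝[>] 0) (𝓝 0) := tendsto_nhdsWithin_of_tendsto_nhds tendsto_id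
  have hhalf : ∀ᶠ s : ℝ in 𝓝[>] 0, s ≤ 1 / 2 :=
    (hid.eventually (gt_mem_nhds (by norm_num : (0 : ℝ) < 1 / 2))).mono fun _ h => h.le
  have hrpow : ∀ a : ℝ, 0 < a → Tendsto (fun s : ℝ => s ^ a) (𝓝[>] 0) (𝓝 0) := by
    intro a ha
    have := (Real.continuousAt_rpow_const 0 a (Or.inr ha.le)).tendsto
    rw [Real.zero_rpow ha.ne'] at this
    exact this.mono_left nhdsWithin_le_nhds
  set K := 8 * (16 * c ^ 4) ^ (1 / (4 * (k : ℝ) + 4)) with hK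
  have hK0 : 0 < K := by positivity
  set a := 1 / 8 * (1 / (4 * (k : ℝ) + 4)) with ha
  have ha0 : 0 < a := by positivity
  have ha1 : a ≤ 1 := by
    have : 1 / (4 * (k : ℝ) + 4) ≤ 1 := by
      rw [div_le_one (by positivity)]
      have : (0 : ℝ) ≤ k := by positivity
      linarith
    rw [ha]; linarith
  have h2 : ∀ᶠ s : ℝ in 𝓝[>] 0, s ^ 2 * ((ℓ : ℝ) + 1) < 1 := by
    have : Tendsto (fun s : ℝ => s ^ 2 * ((ℓ : ℝ) + 1)) (𝓝[>] 0) (𝓝 0) := by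
      simpa using (hid.pow 2).mul_const ((ℓ : ℝ) + 1)
    exact this.eventually (gt_mem_nhds one_pos)
  -- Half of the power of `s` absorbs the constants; the other half beats the target, whose exponent
  -- `3 * a / 512` is below `1 / 2`.
  have h3 : ∀ᶠ s : ℝ in 𝓝[>] 0, (10 + 2 * (ℓ : ℝ)) * s ^ (1 / 2 : ℝ) <
      216 * K ^ (3 / 512 : ℝ) := by
    have : Tendsto (fun s : ℝ => (10 + 2 * (ℓ : ℝ)) * s ^ (1 / 2 : ℝ)) (𝓝[>] 0) (𝓝 0) := by
      simpa using (hrpow (1 / 2) (by norm_num)).const_mul (10 + 2 * (ℓ : ℝ))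
    exact this.eventually (gt_mem_nhds (by positivity))
  have h4 : ∀ᶠ s : ℝ in 𝓝[>] 0, (K * s ^ a / 8) ^ k < c := by
    have : Tendsto (fun s : ℝ => (K * s ^ a / 8) ^ k) (𝓝[>] 0) (𝓝 0) := by
      have := ((((hrpow a ha0).const_mul K).div_const 8).pow k)
      simpa [show k ≠ 0 by omega] using this
    exact this.eventually (gt_mem_nhds hc)
  have h5 : ∀ᶠ s : ℝ in 𝓝[>] 0,
      (2 * ((4 * C) ^ k * (1 / s) ^ (4 * k))) ^ 2 ≤ (2 : ℝ) ^ (1 / s) := by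
    have hinv : Tendsto (fun s : ℝ => 1 / s) (𝓝[>] 0) atTop := by
      simpa using tendsto_inv_nhdsGT_zero (𝕜 := ℝ)
    have hlo := (isLittleO_pow_exp_pos_mul_atTop (8 * k) (Real.log_pos one_lt_two)).const_mul_left
      ((2 * (4 * C) ^ k) ^ 2)
    have := hinv.eventually (hlo.bound one_pos)
    filter_upwards [this, hpos] with s hs hs0
    have hexp : Real.exp (Real.log 2 * (1 / s)) = (2 : ℝ) ^ (1 / s) :=
      (Real.rpow_def_of_pos two_pos _).symm
    rw [one_mul, Real.norm_eq_abs, Real.norm_eq_abs, Real.abs_exp, hexp] at hs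
    refine le_trans (le_of_eq ?_) ((le_abs_self _).trans hs)
    rw [show 8 * k = 4 * k * 2 by ring, pow_mul (1 / s)]
    ring
  filter_upwards [hpos, hhalf, h2, h3, h4, h5] with s hs0 hs h2 h3 h4 h5
  refine ⟨hs, h2, ?_, ?_, h5⟩
  · rw [muParam_sq k c hs0, ← hK, ← ha, Real.mul_rpow hK0.le (by positivity), mul_pow, mul_pow,
      ← Real.rpow_natCast (K ^ _), ← Real.rpow_mul hK0.le, ← Real.rpow_mul hs0.le,
      ← Real.rpow_natCast (s ^ _), ← Real.rpow_mul hs0.le]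
    norm_num
    have h6 : s ^ (1 / 2 : ℝ) ≤ s ^ (a * (1 / 512) * 3) :=
      Real.rpow_le_rpow_of_exponent_ge hs0 (by linarith) (by linarith)
    have h7 : s = s ^ (1 / 2 : ℝ) * s ^ (1 / 2 : ℝ) := by
      rw [← Real.rpow_add hs0]; norm_num
    calc (10 + 2 * (ℓ : ℝ)) * s = (10 + 2 * (ℓ : ℝ)) * s ^ (1 / 2 : ℝ) * s ^ (1 / 2 : ℝ) := by
          rw [mul_assoc, ← h7]
      _ ≤ 216 * K ^ (3 / 512 : ℝ) * s ^ (a * (1 / 512) * 3) :=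
          mul_le_mul h3.le h6 (by positivity) (by positivity)
      _ = _ := by ring
  · rw [muParam_sq k c hs0, ← hK, ← ha]
    have hp : 0 < (K * s ^ a / 8) ^ k := by positivity
    have : 1 ≤ c * ((K * s ^ a / 8) ^ k)⁻¹ := by
      rw [← div_eq_mul_inv, le_div_iff₀ hp]; linarith
    linarith

/-- Sums of the error terms for a sample of size `⌈1 / s⌉₊`. -/
theorem sample_error_le {ℓ : ℕ} (hℓ : 1 ≤ ℓ) {s : ℝ} (hs0 : 0 < s) (hs : s ≤ 1) :
    4 * s + (1 - 1 / (2 * (ℓ : ℝ))) ^ ⌈1 / s⌉₊ + ⌈1 / s⌉₊ * (3 * s ^ 2) ≤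
      (10 + 2 * (ℓ : ℝ)) * s := by
  have hℓ' : (1 : ℝ) ≤ ℓ := by exact_mod_cast hℓ
  set t := ⌈1 / s⌉₊
  have ht : 1 / s ≤ t := Nat.le_ceil _
  have ht' : (t : ℝ) < 1 / s + 1 := Nat.ceil_lt_add_one (by positivity)
  have hts : 1 ≤ t * s := by rwa [div_le_iff₀ hs0] at ht
  have hts' : t * s ≤ 2 := by
    have : t * s < (1 / s + 1) * s := by gcongr
    have h1 : (1 / s + 1) * s = 1 + s := by field_simp
    linarith
  -- The crude estimate `(1 - p) ^ t ≤ exp (-t * p) ≤ 1 / (t * p)` suffices, together with `t * s ≥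
  -- 1`.
  have h1 : (1 - 1 / (2 * (ℓ : ℝ))) ^ t ≤ 2 * ℓ * s := by
    set p := 1 / (2 * (ℓ : ℝ)) with hp
    have hp0 : 0 < p := by positivity
    have hp1 : p ≤ 1 := by rw [hp, div_le_one (by positivity)]; linarith
    have hexp : (1 - p) ^ t ≤ Real.exp (-(t * p)) := by
      calc (1 - p) ^ t ≤ Real.exp (-p) ^ t := by
            apply pow_le_pow_left₀ (by linarith)
            have := Real.add_one_le_exp (-p); linarith
        _ = Real.exp (-(t * p)) := by rw [← Real.exp_nat_mul]; ring_nf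
    have hpp : p * (2 * ℓ) = 1 := by rw [hp]; field_simp
    have htp : 0 < t * p := by
      have : (0 : ℝ) < t := lt_of_lt_of_le (by positivity) ht
      positivity
    refine hexp.trans ?_
    rw [Real.exp_neg, inv_le_iff_one_le_mul₀ (Real.exp_pos _)]
    calc (1 : ℝ) ≤ t * s := hts
      _ = 2 * ℓ * s * (t * p) := by linear_combination (-(t * s) : ℝ) * hpp
      _ ≤ 2 * ℓ * s * Real.exp (t * p) := by
          gcongr
          have := Real.add_one_le_exp (t * p); linarith
  have h3 : t * (3 * s ^ 2) ≤ 6 * s := by nlinarith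
  linarith

/-- The number of parts of the common refinement. -/
theorem refinement_card_le {k : ℕ} {C : ℝ} (hC : 1 ≤ C) {ℓ : ℕ} (hℓ : 1 ≤ ℓ) {s b : ℝ}
    (hs0 : 0 < s) (hs : s ≤ 1) (hb : 2 ≤ b)
    (h : (2 * ((4 * C) ^ k * (1 / s) ^ (4 * k))) ^ 2 ≤ (2 : ℝ) ^ (1 / s)) :
    ((⌊(C / (s ^ 2 / 2) ^ 2) ^ k⌋₊ : ℝ) + 1) ^ ⌈1 / s⌉₊ ≤
      b ^ ((ℓ : ℝ) * (2 * (ℓ : ℝ)) ^ ℓ * ((s ^ 2) ^ ℓ)⁻¹) := by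
  have hℓ' : (1 : ℝ) ≤ ℓ := by exact_mod_cast hℓ
  have hs1 : 1 ≤ 1 / s := by rwa [le_div_iff₀ hs0, one_mul]
  set p := (4 * C) ^ k * (1 / s) ^ (4 * k) with hp
  have hp1 : 1 ≤ p := one_le_mul_of_one_le_of_one_le (one_le_pow₀ (by linarith)) (one_le_pow₀ hs1)
  have hpe : (C / (s ^ 2 / 2) ^ 2) ^ k = p := by
    rw [hp, pow_mul, ← mul_pow]
    congr 1
    field_simp
    norm_num
  have hM : (⌊(C / (s ^ 2 / 2) ^ 2) ^ k⌋₊ : ℝ) + 1 ≤ 2 * p := by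
    rw [hpe]
    have := Nat.floor_le (show 0 ≤ p by linarith)
    linarith
  have ht : (⌈1 / s⌉₊ : ℝ) ≤ 2 * (1 / s) := by
    have := Nat.ceil_lt_add_one (show 0 ≤ 1 / s by positivity)
    linarith
  -- Of the allowed exponent only `1 / s ^ 2` is needed: one factor `1 / s` is the sample size, the
  -- other dominates the logarithm of `(2 * p) ^ 2`.
  have hE : 1 / s * (1 / s) ≤ (ℓ : ℝ) * (2 * (ℓ : ℝ)) ^ ℓ * ((s ^ 2) ^ ℓ)⁻¹ := by
    have h1 : 1 ≤ (ℓ : ℝ) * (2 * (ℓ : ℝ)) ^ ℓ :=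
      one_le_mul_of_one_le_of_one_le hℓ' (one_le_pow₀ (by linarith))
    have h2 : 1 / s * (1 / s) ≤ ((s ^ 2) ^ ℓ)⁻¹ := by
      have h3 : (s ^ 2) ^ ℓ ≤ s ^ 2 := pow_le_of_le_one (by positivity) (by nlinarith) (by omega)
      rw [show 1 / s * (1 / s) = (s ^ 2)⁻¹ by field_simp]
      gcongr
    nlinarith
  calc ((⌊(C / (s ^ 2 / 2) ^ 2) ^ k⌋₊ : ℝ) + 1) ^ ⌈1 / s⌉₊ ≤ (2 * p) ^ ⌈1 / s⌉₊ := by gcongr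
    _ = (2 * p) ^ (⌈1 / s⌉₊ : ℝ) := (Real.rpow_natCast _ _).symm
    _ ≤ (2 * p) ^ (2 * (1 / s)) := Real.rpow_le_rpow_of_exponent_le (by linarith) ht
    _ = ((2 * p) ^ 2) ^ (1 / s) := by
        rw [Real.rpow_mul (by linarith)]; norm_num
    _ ≤ ((2 : ℝ) ^ (1 / s)) ^ (1 / s) := Real.rpow_le_rpow (by positivity) h (by positivity)
    _ = (2 : ℝ) ^ (1 / s * (1 / s)) := (Real.rpow_mul (by norm_num) _ _).symm
    _ ≤ b ^ (1 / s * (1 / s)) := Real.rpow_le_rpow (by norm_num) hb (by positivity)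
    _ ≤ _ := Real.rpow_le_rpow_of_exponent_le (by linarith) hE

end SliceReg

/-! ### The proposition -/

open SliceReg
theorem proposition4p2 (k : ℕ) (hk : 1 ≤ k) :
    (∃ c : ℝ, IsRemovalConstant k c) ∧
    ∀ c : ℝ, IsRemovalConstant k c →
    ∀ ℓ : ℕ, 1 ≤ ℓ →
    ∃ ε₀ : ℝ, 0 < ε₀ ∧ ∀ ε : ℝ, 0 < ε → ε < ε₀ →
    ∃ n₀ : ℕ, ∀ r s : ℕ, 1 ≤ r → r ≤ ℓ → 1 ≤ s → s ≤ ℓ →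
    ∀ (α : Type*) [Fintype α] [DecidableEq α] (H : ThreeGraph α) (U V W : Finset α),
      n₀ ≤ Fintype.card α →
      H.IsTripartite U V W →
      H.svc < (k : ℕ∞) →
    ∀ 𝒢 : ColoredBipartite (Fin (r + 1)) (Fin (s + 1)),
      (∀ x ∈ U, IsReducedSlice H V W ℓ ε 𝒢 x) →
      (∀ i, i ≠ 0 → ((𝒢.nbhdLeft 2 i).card : ℝ) ≤ ε * ((s : ℝ) + 1)) →
      (∀ j, j ≠ 0 → ((𝒢.nbhdRight 2 j).card : ℝ) ≤ ε * ((r : ℝ) + 1)) →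
    ∃ P : Finpartition V,
      H.IsAlmostGoodPartition U W (6 * muParam k c ε ^ (1 / 512 : ℝ)) P ∧
      (P.parts.card : ℝ) ≤
        (2 * c * ((muParam k c ε / 8) ^ k)⁻¹) ^
          ((ℓ : ℝ) * (2 * (ℓ : ℝ)) ^ ℓ * (ε ^ ℓ)⁻¹) := by
  refine ⟨exists_isRemovalConstant k, fun c hc ℓ hℓ => ?_⟩
  obtain ⟨C, hC⟩ := exists_isPackingConstant k
  obtain ⟨s₀, hs₀, hsmall⟩ := mem_nhdsGT_iff_exists_Ioo_subset.1 (eventually_small hk hc.1 C ℓ)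
  rw [Set.mem_Ioi] at hs₀
  refine ⟨s₀ ^ 2, by positivity, fun ε hε hε₀ => ⟨0, ?_⟩⟩
  obtain ⟨w, hw0, rfl⟩ : ∃ w : ℝ, 0 < w ∧ w ^ 2 = ε :=
    ⟨Real.sqrt ε, Real.sqrt_pos.2 hε, Real.sq_sqrt hε.le⟩
  have hw : w < s₀ := lt_of_pow_lt_pow_left₀ 2 hs₀.le hε₀
  obtain ⟨hw2, hwℓ, hη, hb, hcount⟩ := hsmall ⟨hw0, hw⟩
  intro r s _ hr _ _ α _ _ H U V W _ htri hsvc 𝒢 hred _ hright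
  -- A single edge of color `2` at `j` would give `1 ≤ ε * (r + 1) ≤ ε * (ℓ + 1) < 1`.
  have h2 : ∀ i j, j ≠ 0 → 𝒢.color i j ≠ 2 := by
    intro i j hj hij
    have h1 : (1 : ℝ) ≤ ((𝒢.nbhdRight 2 j).card : ℝ) := by
      have : 0 < (𝒢.nbhdRight 2 j).card :=
        Finset.card_pos.2 ⟨i, by simp [ColoredBipartite.nbhdRight, hij]⟩
      exact_mod_cast this
    have h3 : w ^ 2 * ((r : ℝ) + 1) ≤ w ^ 2 * ((ℓ : ℝ) + 1) := by
      have : (r : ℝ) ≤ ℓ := by exact_mod_cast hr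
      gcongr
    linarith [hright j hj]
  have hμ : 0 < muParam k c (w ^ 2) := by
    have := hc.1
    unfold muParam
    positivity
  -- With diameter scale `q = w ^ 2` and `⌈1 / w⌉₊` samples, both the union bound over the sample
  -- and the proportion of missed pairs are linear in `w`.
  obtain ⟨P, hP, hPc⟩ := exists_isAlmostGoodPartition htri.1 hsvc hC (q := w ^ 2) (by positivity)
    (by nlinarith) (Nat.lt_floor_add_one _) hℓ hw0 hw2 hred h2 ⌈1 / w⌉₊
    (η := 6 * muParam k c (w ^ 2) ^ (1 / 512 : ℝ)) (by positivity)
    ((sample_error_le hℓ hw0 (by linarith)).trans hη)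
  refine ⟨P, hP, le_trans ?_ (refinement_card_le hC.1 hℓ hw0 (by linarith) hb hcount)⟩
  exact_mod_cast hPc
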